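/- **Theorem 1.** Consider the $L\times L$ square lattice of cells with periodic boundary conditions ($L\ge 1$). Each cell carries a charge $1$, $\psi$ (fermion) or $\sigma$ (Ising anyon), with $\psi\times\psi=1$, $\psi\times\sigma=\sigma$, $\sigma\times\sigma=1+\psi$. The initial state is a vacuum state, and all charges are measured perfectly at the end of each of the periods $0,1,2,\dots$. *Errors.* In each period, independently on each edge (pair of adjacent cells), a pair of $\sigma$'s is created on the two cells with probability $p$, a pair of $\psi$'s with probability $p$, and nothing happens with probability $1-2p$. Let $A_t$ and $F_t$ be the sets of edges with a $\sigma$-pair, respectively a $\psi$-pair, in period $t$, and let $\partial A_t$ be the set of cells with an odd number of edges of $A_t$ (the unexpected changes of anyonic charge). *Correction of the anyons.* At the end of period $t$, $\partial A_t$ is paired by a minimum-weight perfect matching (MWPM), with the periodic Manhattan distance as weight; matched cells are joined by shortest strings. These strings and the previous chains (as changed by the moves of period $t$) are joined at common end points, and closed chains are dropped, until the remaining open chains pair all the anyons that are present. In the next period, the two anyons of each pair are moved towards each other, one cell each, along a shortest path homologous (with fixed end points, integer coefficients) to the chain that connects them; if one step separates them along this path, only one is moved. The world-lines $W$ consist of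 the moves and of the measurements that detect a $\sigma$. A $\sigma$ is present in a cell exactly if the parity of the number of $\sigma$'s brought there by errors and moves is odd. *Fermions.* The fermionic parity of a cell (including fermions swallowed by a $\sigma$) changes by the edges of $F_t$ and by fermionic charge transferred together with anyons over edges on which anyons are created or moved in period $t$. Which of these edges transfer fermionic charge is arbitrary (this contains all the outcomes of the fusions $\sigma\times\sigma=1+\psi$). A fermion is visible in a cell of odd fermionic parity without $\sigma$. To evaluate the state after $t$ periods, the correction of the anyons is continued without further errors until no anyon is left; then all unexpected changes (in space-time) of visible fermionic charge are paired by MWPM with the $(2+1)$-dimensional Manhattan distance, periodic in space, and the fermions are corrected along the corresponding shortest strings. *Logical failure* after $t$ periods means that, for some choice of minimal matchings, chains, shortest paths and fermionic transfers compatible with the errors of the first $t$ periods, (i) the anyonic error edges together with $W$ contain a closed space-time path that winds around the torus with non-zero integer winding, or (ii) fermionic charge has in total (by fermionic errors, transfers with anyons, and the final correction) been carried an odd number of times around the torus in one of its two directions. Let $P_{\mathrm{fail}}(L,T,p)$ be the probability that there is a logical failure after $t$ periods for some $t\le T$. Then the procedure can be carried out to completion for every error history, and there is a threshold $p_c>0$,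 with $p_c\ge 15^{-14}$ ($\approx 3\times10^{-17}$), such that for every $p$ with $0\le p<p_c$ and $2p<1$ there are constants $C,c>0$, depending only on $p$, with $$P_{\mathrm{fail}}(L,T,p)\;\le\; T\cdot C\,e^{-cL}\qquad\text{for all } L\ge1,\ T\ge0,$$ that is, the logical failure probability per correction period is exponentially small in $L$. -/

import Mathlib

open scoped BigOperators

namespace IsingTorus

/-! ### The torus and pair-creation errors -/

/-- Cells of the `L × L` square lattice with periodic boundary conditions. -/
abbrev Cell (L : ℕ) := Fin 2 → ZMod L

/-- The edge `(x, d)` joins the adjacent cells `x` and `x + e_d`. -/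
abbrev Edge (L : ℕ) := Cell L × Fin 2

/-- Displacements in the universal cover `ℤ²` of the torus. -/
abbrev Disp := Fin 2 → ℤ

/-- What happens on an edge between two rounds of charge measurement: nothing, creation of a
pair of (non-Abelian) `σ` anyons, or creation of a pair of `ψ` fermions. -/
inductive Err where
  | none
  | sigma
  | psi
  deriving DecidableEq

instance : Fintype Err where
  elems := {Err.none, Err.sigma, Err.psi}
  complete := by rintro (_ | _ | _) <;> simp

/-- Probability of each kind of event on one edge during one period. -/
def Err.prob (p : ℝ) : Err → ℝ
  | .none => 1 - 2 * p
  | .sigma => p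
  | .psi => p

/-- Reduction of a point of `ℤ²` to a cell of the torus. -/
def toCell (L : ℕ) (v : Disp) : Cell L := fun d => (v d : ZMod L)

/-- Manhattan length of a displacement. -/
def l1 (v : Disp) : ℕ := ∑ d, (v d).natAbs

/-- The mod 2 boundary of a set of edges (given by its indicator): the parity of the number of
edges of the set that are incident upon the cell `x`. -/
def boundary {L : ℕ} (c : Edge L → ZMod 2) (x : Cell L) : ZMod 2 :=
  ∑ d, (c (x, d) + c (x - Pi.single d 1, d))

/-- Indicator of the edges on which a pair of anyons is created. -/
def anyonErr {L : ℕ} (e : Edge L → Err) (b : Edge L) : ZMod 2 :=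
  if e b = Err.sigma then 1 else 0

/-- Indicator of the edges on which a pair of fermions is created. -/
def fermionErr {L : ℕ} (e : Edge L → Err) (b : Edge L) : ZMod 2 :=
  if e b = Err.psi then 1 else 0

/-! ### Minimum-weight perfect matching -/

/-- A multiset `M` of strings (with end points `ends`) is a perfect matching of the set `D`: every
point of `D` is the end point of exactly one string, and there are no other end points. -/
def IsMatching {V α : Type} (ends : α → Multiset V) (D : Set V) (M : Multiset α) : Prop :=
  (M.bind ends).Nodup ∧ ∀ v, v ∈ M.bind ends ↔ v ∈ D

/-- A perfect matching of minimal total weight. -/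
def IsMWPM {V α : Type} (ends : α → Multiset V) (weight : α → ℕ) (D : Set V) (M : Multiset α) :
    Prop :=
  IsMatching ends D M ∧
    ∀ M', IsMatching ends D M' → (M.map weight).sum ≤ (M'.map weight).sum

/-! ### Pairs of anyons and their motion -/

/-- A homology class of paths between two cells: the initial cell and the displacement of the
lifted path. It determines the final cell; the shortest paths in the class are
the monotone paths, of length `l1 disp`. -/
structure Link (L : ℕ) where
  src : Cell L
  disp : Disp

/-- The final cell. -/
def Link.tgt {L : ℕ} (l : Link L) : Cell L := l.src + toCell L l.disp

/-- The two end points. -/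
def Link.ends {L : ℕ} (l : Link L) : Multiset (Cell L) := {l.src, l.tgt}

/-- Length of the shortest paths in the class. -/
def Link.len {L : ℕ} (l : Link L) : ℕ := l1 l.disp

/-- The same paths, traversed backwards. -/
def Link.reverse {L : ℕ} (l : Link L) : Link L := ⟨l.tgt, -l.disp⟩

/-- The four directions: `(d, true)` is `+e_d` and `(d, false)` is `-e_d`. -/
abbrev Dir := Fin 2 × Bool

/-- The unit vector in a direction. -/
def Dir.vec (s : Dir) : Disp := Pi.single s.1 (if s.2 then 1 else -1)

/-- The opposite direction. -/
def Dir.opp (s : Dir) : Dir := (s.1, !s.2)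

/-- A move takes the content of a cell to the adjacent cell in the given direction. -/
abbrev Move (L : ℕ) := Cell L × Dir

/-- The cell to which a move leads. -/
def Move.dest {L : ℕ} (m : Move L) : Cell L := m.1 + toCell L (Dir.vec m.2)

/-- The edge along which a move takes place. -/
def Move.edge {L : ℕ} (m : Move L) : Edge L :=
  if m.2.2 then (m.1, m.2.1) else (m.1 - Pi.single m.2.1 1, m.2.1)

/-- The parity change of the number of anyons in the cell `x` that a set of moves causes. -/
def moveBoundary {L : ℕ} (ms : Multiset (Move L)) (x : Cell L) : ZMod 2 :=
  (ms.map fun m => (if m.1 = x then 1 else 0) + (if Move.dest m = x then 1 else 0)).sum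

/-- `Advance l l' ms`: during one period the two anyons at the ends of `l` are moved towards
each other by one cell each, along a shortest path in the class `l`, which leaves the class `l'`;
if they are adjacent along `l`, only one of them is moved. The moves made are `ms`. -/
inductive Advance {L : ℕ} : Link L → Link L → Multiset (Move L) → Prop
  | first (l : Link L) (s : Dir) (h : l.disp = s.vec) :
      Advance l ⟨l.tgt, 0⟩ {(l.src, s)}
  | second (l : Link L) (s : Dir) (h : l.disp = s.vec) :
      Advance l ⟨l.src, 0⟩ {(l.tgt, s.opp)}
  | both (l : Link L) (s s' : Dir) (h : l1 (l.disp - s.vec - s'.vec) + 2 = l1 l.disp) :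
      Advance l ⟨l.src + toCell L s.vec, l.disp - s.vec - s'.vec⟩ {(l.src, s), (l.tgt, s'.opp)}

/-- One pair of anyons during one period. -/
structure Motion (L : ℕ) where
  before : Link L
  after : Link L
  moves : Multiset (Move L)
  valid : Advance before after moves

/-- Elementary steps in forming chains out of strings: strings that share an
end point are joined there, and a closed chain is discarded. -/
inductive Reconnect {L : ℕ} : Multiset (Link L) → Multiset (Link L) → Prop
  | flip (l : Link L) (Q : Multiset (Link L)) : Reconnect (l ::ₘ Q) (l.reverse ::ₘ Q)
  | join (l l' : Link L) (Q : Multiset (Link L)) (h : l.tgt = l'.src) :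
      Reconnect (l ::ₘ l' ::ₘ Q) (⟨l.src, l.disp + l'.disp⟩ ::ₘ Q)
  | drop (l : Link L) (Q : Multiset (Link L)) (h : l.src = l.tgt) : Reconnect (l ::ₘ Q) Q

/-! ### Charges

Period `t` lies between the states `t` and `t + 1`; the state `t + 1` is the one found by the charge
measurement at the end of period `t`, and the state `0` is a vacuum. -/

/-- Parity of the number of `σ` anyons in each cell (a cell of odd parity carries a `σ`, since
`σ × σ` contains only `1` and `ψ`), after error events and moves. -/
def sigmaCharge {L : ℕ} (err : ℕ → Edge L → Err) (ms : ℕ → Multiset (Move L)) :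
    ℕ → Cell L → ZMod 2
  | 0 => 0
  | t + 1 => sigmaCharge err ms t + boundary (anyonErr (err t)) + moveBoundary (ms t)

/-- Fermionic parity of each cell, including a fermion that has been swallowed by an anyon. Besides
the fermionic error events, it is changed by the fermionic charge `c t b` that is transferred over
the edge `b` in period `t` together with anyons. -/
def psiCharge {L : ℕ} (err : ℕ → Edge L → Err) (c : ℕ → Edge L → ZMod 2) :
    ℕ → Cell L → ZMod 2
  | 0 => 0
  | t + 1 => psiCharge err c t + boundary (fermionErr (err t) + c t)

/-- In state `t` a fermion is detected in the cell `x`: the cell has odd fermionic parity and carries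
no anyon, where `pairs t` are the pairs of anyons in state `t`. -/
def PsiVisible {L : ℕ} (err : ℕ → Edge L → Err) (c : ℕ → Edge L → ZMod 2)
    (pairs : ℕ → Multiset (Link L)) (t : ℕ) (x : Cell L) : Prop :=
  psiCharge err c t x = 1 ∧ ∀ l ∈ pairs t, x ∉ l.ends

/-- A homology class of space-time paths from the period and cell `src` to the period `time`. -/
structure STLink (L : ℕ) where
  src : ℕ × Cell L
  time : ℕ
  disp : Disp

/-- The two end points. -/
def STLink.ends {L : ℕ} (l : STLink L) : Multiset (ℕ × Cell L) :=
  {l.src, (l.time, l.src.2 + toCell L l.disp)}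

/-- The length, in the `2+1`-dimensional Manhattan metric, of the shortest paths in the class. -/
def STLink.len {L : ℕ} (l : STLink L) : ℕ := Nat.dist l.src.1 l.time + l1 l.disp

/-- The (signed) number of times that a path in the class crosses the closed seam of the torus
that separates coordinate `d = L - 1` from coordinate `d = 0`. -/
def STLink.crossings {L : ℕ} (l : STLink L) (d : Fin 2) : ℤ :=
  (((l.src.2 d).val : ℤ) + l.disp d) / (L : ℤ)

/-! ### Continuous error correction -/

/-- A possible course of the error correction for a given error history `err`, up to a time
`horizon` at which errors have ceased and all anyons have been fused.
Ties between minimal matchings and shortest paths may be broken in any way, and the fusion outcomes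
are arbitrary subject to conservation of the fermionic parity. -/
structure Run {L : ℕ} (err : ℕ → Edge L → Err) where
  /-- the number of periods considered -/
  horizon : ℕ
  /-- the pairs of anyons connected by a chain, with the class of the chain, in state `t` -/
  pairs : ℕ → Multiset (Link L)
  /-- the motion of these pairs in period `t` -/
  motions : ℕ → Multiset (Motion L)
  /-- the hypothesis about the anyonic errors of period `t`, as strings -/
  hyp : ℕ → Multiset (Link L)
  /-- the fermionic charge transferred over each edge by anyons in period `t` -/
  transfer : ℕ → Edge L → ZMod 2
  /-- the matching of the unexpected changes of fermionic charge -/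
  fermi : Multiset (STLink L)
  quiet : ∀ t, horizon ≤ t → ∀ b, err t b = Err.none
  pairs_zero : pairs 0 = 0
  pairs_horizon : pairs horizon = 0
  /-- all pairs are moved -/
  motions_before : ∀ t < horizon, (motions t).map Motion.before = pairs t
  /-- the hypothesis is a minimum-weight perfect matching of the unexpected changes of
  anyonic charge in the Manhattan metric of the torus -/
  hyp_spec : ∀ t < horizon,
    IsMWPM Link.ends Link.len {x | boundary (anyonErr (err t)) x = 1} (hyp t)
  /-- the new chains are composed of the previous ones and of the strings of the hypothesis -/
  pairs_succ : ∀ t < horizon,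
    Relation.ReflTransGen Reconnect ((motions t).map Motion.after + hyp t) (pairs (t + 1))
  /-- the pairs found are a perfect matching of the anyons that are present -/
  pairs_matching : ∀ t ≤ horizon,
    IsMatching Link.ends
      {x | sigmaCharge err (fun k => ((motions k).map Motion.moves).sum) t x = 1} (pairs t)
  /-- anyons carry fermionic charge over edges on which they are created or moved only -/
  transfer_spec : ∀ t < horizon, ∀ b, transfer t b ≠ 0 →
    err t b = Err.sigma ∨ ∃ n ∈ motions t, ∃ m ∈ n.moves, Move.edge m = b
  /-- the unexpected changes of fermionic charge (appearances and disappearances of visible fermions)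
  are matched with minimal weight in the `2+1`-dimensional Manhattan metric -/
  fermi_spec :
    IsMWPM STLink.ends STLink.len
      {v | v.1 < horizon ∧
        ¬ (PsiVisible err transfer pairs v.1 v.2 ↔ PsiVisible err transfer pairs (v.1 + 1) v.2)}
      fermi

namespace Run

variable {L : ℕ} {err : ℕ → Edge L → Err}

/-- Space-time edges that belong to an anyonic error event or to an anyon world-line (an
intentional move, or a charge measurement that detects an anyon), lifted to the
universal cover `ℤ²` of the torus. -/
inductive AnyonStep (R : Run err) : ℕ × Disp → ℕ × Disp → Prop
  | error (t : ℕ) (y : Disp) (d : Fin 2) (ht : t < R.horizon)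
      (h : err t (toCell L y, d) = Err.sigma) : AnyonStep R (t, y) (t, y + Pi.single d 1)
  | move (t : ℕ) (y : Disp) (d : Fin 2) (ht : t < R.horizon)
      (h : ∃ n ∈ R.motions t, ∃ m ∈ n.moves, Move.edge m = (toCell L y, d)) :
      AnyonStep R (t, y) (t, y + Pi.single d 1)
  | wait (t : ℕ) (y : Disp) (ht : t < R.horizon)
      (h : ∃ l ∈ R.pairs (t + 1), toCell L y ∈ l.ends) : AnyonStep R (t, y) (t + 1, y)

/-- Anyonic failure: anyonic error events and anyon world-lines contain a closed path that winds
around the torus. -/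
def AnyonFailure (R : Run err) : Prop :=
  ∃ (t : ℕ) (y w : Disp), w ≠ 0 ∧
    Relation.EqvGen R.AnyonStep (t, y) (t, y + fun d => (L : ℤ) * w d)

/-- The parity of the number of times that fermionic charge has been carried over the seam of the
torus in direction `d`, by errors, by anyons and by the final correction of the fermions. -/
def fermionWinding [NeZero L] (R : Run err) (d : Fin 2) : ZMod 2 :=
  (∑ t ∈ Finset.range R.horizon, ∑ x : Cell L with x d + 1 = 0,
      (fermionErr (err t) (x, d) + R.transfer t (x, d))) +
    (R.fermi.map fun l => (l.crossings d : ZMod 2)).sum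

/-- Fermionic failure: a fermion has effectively been dragged around the torus. -/
def FermionFailure [NeZero L] (R : Run err) : Prop :=
  ∃ d, R.fermionWinding d ≠ 0

end Run

/-- The error history that agrees with `ω` in the first `t` periods and is error-free afterwards. -/
def truncate {L T : ℕ} (ω : Fin T → Edge L → Err) (t : ℕ) : ℕ → Edge L → Err :=
  fun k b => if h : k < T then (if k < t then ω ⟨k, h⟩ b else Err.none) else Err.none

/-- The stored information can be lost within `T` periods: for some `t ≤ T`, some course
of the error correction for the errors of the first `t` periods, followed by its error-free
completion, results in a logical error. -/
def Fails {L T : ℕ} [NeZero L] (ω : Fin T → Edge L → Err) : Prop :=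
  ∃ t ≤ T, ∃ R : Run (truncate ω t), R.AnyonFailure ∨ R.FermionFailure

open Classical in
/-- The probability of failure within `T` periods, when events on different edges and in different
periods are independent. -/
noncomputable def failureProb (L T : ℕ) [NeZero L] (p : ℝ) : ℝ :=
  ∑ ω : Fin T → Edge L → Err, if Fails ω then ∏ k, ∏ b, (ω k b).prob p else 0

end IsingTorus

namespace IsingTorus

/-! ### Space-time clusters -/

/-! A run is recorded in one finite set `Run.edges` of space-time edges: error events, moves,
measurements that detect an anyon, and shortest paths for the strings of both matchings. A logical
error forces some connected component of this set to have at least `L` edges, while in every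
component at least a ninth of the edges carry errors. For small `p`, large connected sets with so
many errors are unlikely.

Density (`Run.card_edges_le`). A component is a region that no string leaves, so each matching is
minimal inside it (`IsMWPM.sum_le_of_region`). Let the region contain `E` error edges. The
hypothesis strings there have total length at most `E`, since the `σ` errors yield a competing
matching. The total chain length is a budget: it starts at zero, hypotheses add to it, joining does
not increase it, and every move costs one. Hence there are at most `E` moves, and, as every pair
moves in every period, at most `2E` detections. The fermionic defects are the boundary of a hidden
flow supported on errors, moves and detections (`flow_boundary`), so the fermionic strings have
total length at most `4E`. The sum is `9E`.

Winding (`exists_potential`). A component with fewer than `L` edges has, in each direction, a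
position that none of its edges crosses. Cutting the torus there numbers the sheets of the universal
cover consistently along lifts. Therefore no closed path winds, and a summation by parts mod 2 shows
that the hidden flow and the final correction cross the seam equally often in parity
(`Run.fermionWinding_eq_zero`).

Probability. An exponential Markov inequality bounds the probability that a fixed set `K` has many
errors by a power with exponent `K.card` (`prob_errorCount_le`). The sum over all `K` at a given
vertex is controlled by comparison with bond percolation (`sum_cluster_le_one`). A union bound over
the starting vertices leaves the factor `T * L ^ 2`.

Completion (`nonempty_run`). Once errors have ceased, the total chain length strictly decreases as
long as pairs are left. -/

/-- Vertices of the space-time lattice. -/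
abbrev STVertex (L : ℕ) := ℕ × Cell L

/-- Edges of the space-time lattice: `(v, none)` leads from `v` to the next period, and
`(v, some d)` to the neighbouring cell in direction `d`. -/
abbrev STEdge (L : ℕ) := STVertex L × Option (Fin 2)

section Clusters

variable {L : ℕ}

/-- The final vertex of a space-time edge. -/
def stTgt : STEdge L → STVertex L
  | (v, none) => (v.1 + 1, v.2)
  | (v, some d) => (v.1, v.2 + Pi.single d 1)

/-- Two vertices are joined by edges of `U`. -/
def Joined (U : Finset (STEdge L)) : STVertex L → STVertex L → Prop :=
  Relation.EqvGen fun v w => ∃ e ∈ U, e.1 = v ∧ stTgt e = w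

theorem Joined.of_mem {U : Finset (STEdge L)} {e : STEdge L} (h : e ∈ U) :
    Joined U e.1 (stTgt e) := .rel _ _ ⟨e, h, rfl, rfl⟩

/-- Induction along the generated equivalence. Mostly applied with `f` valued in `Prop`, that is, to
a region that the edges of `U` do not leave. -/
theorem Joined.invariant {U : Finset (STEdge L)} {β : Sort*} {f : STVertex L → β}
    (hf : ∀ e ∈ U, f e.1 = f (stTgt e)) {v w : STVertex L} (h : Joined U v w) : f v = f w := by
  induction h with
  | rel _ _ h => obtain ⟨e, he, rfl, rfl⟩ := h; exact hf e he
  | refl => rfl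
  | symm _ _ _ ih => exact ih.symm
  | trans _ _ _ _ _ ih ih' => exact ih.trans ih'

/-- `K` is a connected set of edges that contains an edge starting in `v`. -/
def IsCluster (v : STVertex L) (K : Finset (STEdge L)) : Prop :=
  (∃ e ∈ K, e.1 = v) ∧ ∀ e ∈ K, Joined K v e.1

/-- The start of the edge of type `o` that ends in `v`. -/
def stBack (v : STVertex L) : Option (Fin 2) → STVertex L
  -- Truncated subtraction: no time edge ends in period `0`, and the value there is a harmless extra
  -- edge in `incident`.
  | none => (v.1 - 1, v.2)
  | some d => (v.1, v.2 - Pi.single d 1)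

theorem stBack_stTgt (e : STEdge L) : stBack (stTgt e) e.2 = e.1 := by
  obtain ⟨v, _ | d⟩ := e <;> simp [stBack, stTgt]

/-- The edges that are incident upon a vertex. -/
def incident (v : STVertex L) : Finset (STEdge L) :=
  Finset.univ.image (fun o => (v, o)) ∪ Finset.univ.image (fun o => (stBack v o, o))

theorem card_incident_le (v : STVertex L) : (incident v).card ≤ 6 := by
  refine (Finset.card_union_le _ _).trans ?_
  refine (add_le_add Finset.card_image_le Finset.card_image_le).trans ?_
  simp

theorem mem_incident_src (e : STEdge L) : e ∈ incident e.1 :=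
  Finset.mem_union_left _ (Finset.mem_image.2 ⟨e.2, Finset.mem_univ _, rfl⟩)

theorem mem_incident_tgt (e : STEdge L) : e ∈ incident (stTgt e) :=
  Finset.mem_union_right _ (Finset.mem_image.2 ⟨e.2, Finset.mem_univ _, by rw [stBack_stTgt]⟩)

/-- The edges that share a vertex with an edge of `K`. -/
def neighbourhood (K : Finset (STEdge L)) : Finset (STEdge L) :=
  K.biUnion fun e => incident e.1 ∪ incident (stTgt e)

theorem card_neighbourhood_le (K : Finset (STEdge L)) : (neighbourhood K).card ≤ 12 * K.card := by
  rw [mul_comm]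
  refine Finset.card_biUnion_le_card_mul _ _ _ fun e _ => ?_
  have h1 := card_incident_le e.1
  have h2 := card_incident_le (stTgt e)
  have h3 := Finset.card_union_le (incident e.1) (incident (stTgt e))
  omega

/-- With `S` the open edges and all edges around `K'` closed, an exploration of `K` from `v` cannot
leave `K'`: the property of being a vertex of `K'` is preserved along edges of `K`, and `v` has it.
-/
theorem IsCluster.subset {v : STVertex L} {K K' S : Finset (STEdge L)} (h : IsCluster v K)
    (h' : IsCluster v K') (hS : K ⊆ S) (hd : Disjoint S (neighbourhood K' \ K')) : K ⊆ K' := by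
  have hmem : ∀ e ∈ K, ∀ w, (w = e.1 ∨ w = stTgt e) →
      (∃ e' ∈ K', w = e'.1 ∨ w = stTgt e') → e ∈ K' := by
    rintro e he w hw ⟨e', he', hw'⟩
    by_contra hcon
    refine Finset.disjoint_left.1 hd (hS he) (Finset.mem_sdiff.2 ⟨?_, hcon⟩)
    refine Finset.mem_biUnion.2 ⟨e', he', Finset.mem_union.2 ?_⟩
    have hinc : e ∈ incident w := by
      rcases hw with rfl | rfl
      · exact mem_incident_src e
      · exact mem_incident_tgt e
    rcases hw' with rfl | rfl
    · exact Or.inl hinc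
    · exact Or.inr hinc
  intro e he
  have hinv := (h.2 e he).invariant (f := fun w => ∃ e' ∈ K', w = e'.1 ∨ w = stTgt e')
    (fun e he => propext ⟨fun hw => ⟨e, hmem e he _ (Or.inl rfl) hw, Or.inr rfl⟩,
      fun hw => ⟨e, hmem e he _ (Or.inr rfl) hw, Or.inl rfl⟩⟩)
  obtain ⟨e₀, he₀, hv⟩ := h'.1
  exact hmem e he _ (Or.inl rfl) (hinv.mp ⟨e₀, he₀, Or.inl hv.symm⟩)

/-- For independent edges of `B`, each open with probability `q`, this is the probability that `K`
is open and `D` is closed. The remaining edges are free, and their weights sum to one by the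
binomial theorem. -/
theorem sum_weight_Icc {β : Type} [DecidableEq β] (q : ℝ) (B K D : Finset β) (hK : K ⊆ B)
    (hD : D ⊆ B) (hKD : Disjoint K D) :
    ∑ S ∈ Finset.Icc K (B \ D), q ^ S.card * (1 - q) ^ (B.card - S.card) =
      q ^ K.card * (1 - q) ^ D.card := by
  set R := (B \ D) \ K with hR
  have hKBD : K ⊆ B \ D := Finset.subset_sdiff.2 ⟨hK, hKD⟩
  have hcard : B.card = K.card + D.card + R.card := by
    have h1 := Finset.card_sdiff_add_card_eq_card hD
    have h2 := Finset.card_sdiff_add_card_eq_card hKBD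
    rw [← hR] at h2
    omega
  rw [Finset.Icc_eq_image_powerset hKBD, Finset.sum_image]
  · have hone := Finset.sum_pow_mul_eq_add_pow q (1 - q) R
    rw [add_sub_cancel, one_pow] at hone
    refine Eq.trans ?_ (mul_one (q ^ K.card * (1 - q) ^ D.card))
    refine Eq.trans ?_ (congrArg (q ^ K.card * (1 - q) ^ D.card * ·) hone)
    simp only [Finset.mul_sum]
    refine Finset.sum_congr rfl fun S hS => ?_
    rw [Finset.mem_powerset] at hS
    have hdis : Disjoint K S :=
      (Finset.disjoint_sdiff (s := K) (t := B \ D)).mono_right hS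
    have hle := Finset.card_le_card hS
    rw [Finset.card_union_of_disjoint hdis,
      show B.card - (K.card + S.card) = D.card + (R.card - S.card) by omega]
    ring
  · intro S hS S' hS' h
    have hdis : ∀ S ∈ R.powerset, (K ∪ S) \ K = S := fun S hS => by
      rw [Finset.union_sdiff_cancel_left]
      exact (Finset.disjoint_sdiff (s := K) (t := B \ D)).mono_right (Finset.mem_powerset.1 hS)
    rw [← hdis S hS, ← hdis S' hS']
    exact congrArg (· \ K) h

/-- The clusters at `v` are disjoint events for bond percolation. -/
theorem sum_cluster_le_one (𝒦 : Finset (Finset (STEdge L))) (v : STVertex L)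
    (h : ∀ K ∈ 𝒦, IsCluster v K) {q : ℝ} (hq : 0 ≤ q) (hq' : q ≤ 1) :
    ∑ K ∈ 𝒦, (q * (1 - q) ^ 12) ^ K.card ≤ 1 := by
  classical
  -- A finite box for the percolation, on which all the events under consideration depend.
  set B : Finset (STEdge L) := 𝒦.biUnion fun K => K ∪ neighbourhood K with hB
  have hKB : ∀ K ∈ 𝒦, K ⊆ B := fun K hK =>
    Finset.subset_union_left.trans (Finset.subset_biUnion_of_mem (fun K => K ∪ neighbourhood K) hK)
  have hDB : ∀ K ∈ 𝒦, neighbourhood K \ K ⊆ B := fun K hK =>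
    (Finset.sdiff_subset.trans Finset.subset_union_right).trans
      (Finset.subset_biUnion_of_mem (fun K => K ∪ neighbourhood K) hK)
  have h1q : 0 ≤ 1 - q := by linarith
  calc ∑ K ∈ 𝒦, (q * (1 - q) ^ 12) ^ K.card
      ≤ ∑ K ∈ 𝒦, q ^ K.card * (1 - q) ^ (neighbourhood K \ K).card := by
        refine Finset.sum_le_sum fun K _ => ?_
        rw [mul_pow, ← pow_mul]
        refine mul_le_mul_of_nonneg_left ?_ (pow_nonneg hq _)
        refine pow_le_pow_of_le_one h1q (by linarith) ?_
        exact (Finset.card_le_card Finset.sdiff_subset).trans (card_neighbourhood_le K)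
    _ = ∑ K ∈ 𝒦, ∑ S ∈ Finset.Icc K (B \ (neighbourhood K \ K)),
          q ^ S.card * (1 - q) ^ (B.card - S.card) := by
        refine Finset.sum_congr rfl fun K hK => ?_
        rw [sum_weight_Icc q B K _ (hKB K hK) (hDB K hK) Finset.disjoint_sdiff]
    _ = ∑ S ∈ 𝒦.biUnion fun K => Finset.Icc K (B \ (neighbourhood K \ K)),
          q ^ S.card * (1 - q) ^ (B.card - S.card) := by
        rw [Finset.sum_biUnion]
        -- If `S` belongs to both events, each of `K` and `K'` is the whole open cluster of `v`, so
        -- they contain one another.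
        intro K hK K' hK' hne
        refine Finset.disjoint_left.2 fun S hS hS' => hne ?_
        rw [Finset.mem_Icc] at hS hS'
        exact Finset.Subset.antisymm
          ((h K hK).subset (h K' hK') hS.1 (Finset.subset_sdiff.1 hS'.2).2)
          ((h K' hK').subset (h K hK) hS'.1 (Finset.subset_sdiff.1 hS.2).2)
    _ ≤ ∑ S ∈ B.powerset, q ^ S.card * (1 - q) ^ (B.card - S.card) := by
        refine Finset.sum_le_sum_of_subset_of_nonneg ?_ fun S _ _ => by positivity
        intro S hS
        obtain ⟨K, -, hS⟩ := Finset.mem_biUnion.1 hS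
        exact Finset.mem_powerset.2 ((Finset.mem_Icc.1 hS).2.trans Finset.sdiff_subset)
    _ = 1 := by
        rw [Finset.sum_pow_mul_eq_add_pow, add_sub_cancel, one_pow]

/-! ### The probability of a cluster with many errors -/

section Probability

variable {T : ℕ}

/-- The number of error events on edges of `K`. -/
def errorCount [NeZero L] (ω : Fin T → Edge L → Err) (K : Finset (STEdge L)) : ℕ :=
  ∑ k : Fin T, ∑ b : Edge L, if (((k : ℕ), b.1), some b.2) ∈ K ∧ ω k b ≠ Err.none then 1 else 0

theorem sum_err (f : Err → ℝ) : ∑ e, f e = f .none + f .sigma + f .psi := by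
  rw [show (Finset.univ : Finset Err) = {Err.none, Err.sigma, Err.psi} from rfl]
  rw [Finset.sum_insert (by decide), Finset.sum_insert (by decide), Finset.sum_singleton]
  ring

theorem Err.prob_nonneg {p : ℝ} (h0 : 0 ≤ p) (h1 : 2 * p < 1) (e : Err) : 0 ≤ e.prob p := by
  cases e <;> simp only [Err.prob] <;> linarith

/-- By independence the expectation factorises over edges and periods. A spatial edge of `K`
contributes `1 - 2p + 2pμ`, any other edge contributes `1`; time edges of `K` only weaken the bound.
-/
theorem sum_pow_errorCount_le [NeZero L] {p μ : ℝ} (h0 : 0 ≤ p) (h1 : 2 * p < 1) (hμ : 0 ≤ μ)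
    (K : Finset (STEdge L)) :
    ∑ ω : Fin T → Edge L → Err, μ ^ errorCount ω K * ∏ k : Fin T, ∏ b : Edge L, (ω k b).prob p ≤
      (1 + 2 * p * μ) ^ K.card := by
  classical
  set P : Fin T → Edge L → Prop := fun k b => (((k : ℕ), b.1), some b.2) ∈ K with hP
  set g : Fin T → Edge L → Err → ℝ := fun k b e =>
    (if P k b ∧ e ≠ Err.none then μ else 1) * e.prob p with hg
  have e1 : ∀ ω : Fin T → Edge L → Err, μ ^ errorCount ω K * ∏ k, ∏ b, (ω k b).prob p =
      ∏ k, ∏ b, g k b (ω k b) := by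
    intro ω
    simp only [hg, Finset.prod_mul_distrib, errorCount]
    congr 1
    rw [← Finset.prod_pow_eq_pow_sum]
    refine Finset.prod_congr rfl fun k _ => ?_
    rw [← Finset.prod_pow_eq_pow_sum]
    refine Finset.prod_congr rfl fun b _ => ?_
    by_cases h : P k b ∧ ω k b ≠ Err.none
    · rw [if_pos h, if_pos h, pow_one]
    · rw [if_neg h, if_neg h, pow_zero]
  have e2 : ∑ ω : Fin T → Edge L → Err, ∏ k, ∏ b, g k b (ω k b) = ∏ k, ∏ b, ∑ e, g k b e := by
    simp only [Finset.prod_univ_sum, Fintype.piFinset_univ]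
  rw [Finset.sum_congr rfl fun ω _ => e1 ω, e2, ← Finset.prod_product']
  have hA : 1 ≤ 1 + 2 * p * μ := by
    have : 0 ≤ 2 * p * μ := by positivity
    linarith
  calc ∏ x ∈ Finset.univ ×ˢ Finset.univ, ∑ e, g x.1 x.2 e
      ≤ ∏ x ∈ (Finset.univ : Finset (Fin T)) ×ˢ (Finset.univ : Finset (Edge L)),
          if P x.1 x.2 then 1 + 2 * p * μ else 1 := by
        refine Finset.prod_le_prod (fun x _ => Finset.sum_nonneg fun e _ => ?_) fun x _ => ?_
        · refine mul_nonneg ?_ (Err.prob_nonneg h0 h1 e)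
          split_ifs <;> [exact hμ; exact zero_le_one]
        · rw [sum_err]
          by_cases h : P x.1 x.2
          · simp only [hg, h, Err.prob]
            simp
            nlinarith
          · simp only [hg, h, Err.prob]
            simp
            linarith
    _ = (1 + 2 * p * μ) ^ (Finset.univ.filter fun x : Fin T × Edge L => P x.1 x.2).card := by
        rw [Finset.prod_ite, Finset.prod_const, Finset.prod_const_one, mul_one,
          Finset.univ_product_univ]
    _ ≤ _ := by
        refine pow_le_pow_right₀ hA ?_
        refine Finset.card_le_card_of_injOn
          (fun x : Fin T × Edge L => (((x.1 : ℕ), x.2.1), some x.2.2)) ?_ ?_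
        · intro x hx
          exact (Finset.mem_filter.1 hx).2
        · rintro ⟨k, x, d⟩ - ⟨k', x', d'⟩ - h
          simp only [Prod.mk.injEq, Option.some.injEq, Fin.val_inj] at h
          obtain ⟨⟨rfl, rfl⟩, rfl⟩ := h
          rfl

open Classical in
-- Markov's inequality for `(l ^ m) ^ errorCount ω K`, which is at least `l ^ K.card` on the event.
theorem prob_errorCount_le [NeZero L] {p l : ℝ} (h0 : 0 ≤ p) (h1 : 2 * p < 1) (hl : 1 ≤ l)
    (m : ℕ) (K : Finset (STEdge L)) :
    (∑ ω : Fin T → Edge L → Err,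
      if K.card ≤ m * errorCount ω K then ∏ k, ∏ b, (ω k b).prob p else 0) ≤
      ((1 + 2 * p * l ^ m) / l) ^ K.card := by
  have hl0 : 0 < l := by linarith
  rw [div_pow, le_div_iff₀ (pow_pos hl0 _), Finset.sum_mul]
  refine le_trans (Finset.sum_le_sum fun ω _ => ?_)
    (sum_pow_errorCount_le (T := T) h0 h1 (pow_nonneg hl0.le m) K)
  have hprod : 0 ≤ ∏ k, ∏ b, (ω k b).prob p :=
    Finset.prod_nonneg fun k _ => Finset.prod_nonneg fun b _ => Err.prob_nonneg h0 h1 _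
  split_ifs with h
  · rw [mul_comm, ← pow_mul]
    exact mul_le_mul_of_nonneg_right (pow_le_pow_right₀ hl h) hprod
  · rw [zero_mul]
    exact mul_nonneg (pow_nonneg (pow_nonneg hl0.le m) _) hprod

open Classical in
-- Union bound over the starting vertex and the cluster. The factor `ρ` per edge yields `ρ ^ L`
-- because the cluster has at least `L` edges; the rest sums to at most one by `sum_cluster_le_one`.
theorem failureProb_le_of_cluster [NeZero L] {p l q ρ : ℝ} (m : ℕ) (h0 : 0 ≤ p) (h1 : 2 * p < 1)
    (hl : 1 ≤ l) (hq : 0 ≤ q) (hq' : q ≤ 1) (hρ : 0 ≤ ρ) (hρ' : ρ ≤ 1)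
    (hlq : (1 + 2 * p * l ^ m) / l ≤ ρ * (q * (1 - q) ^ 12))
    (hcluster : ∀ ω : Fin T → Edge L → Err, Fails ω → ∃ (k : Fin T) (x : Cell L)
      (K : Finset (STEdge L)), IsCluster ((k : ℕ), x) K ∧ L ≤ K.card ∧
        K.card ≤ m * errorCount ω K) :
    failureProb L T p ≤ T * (L ^ 2 * ρ ^ L) := by
  have hcluster' : ∀ ω : Fin T → Edge L → Err, ∃ K : Finset (STEdge L), Fails ω →
      ∃ (k : Fin T) (x : Cell L), IsCluster ((k : ℕ), x) K ∧ L ≤ K.card ∧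
        K.card ≤ m * errorCount ω K := by
    intro ω
    by_cases h : Fails ω
    · obtain ⟨k, x, K, h⟩ := hcluster ω h
      exact ⟨K, fun _ => ⟨k, x, h⟩⟩
    · exact ⟨∅, fun h' => absurd h' h⟩
  choose Kf hKf using hcluster'
  -- One cluster is selected for each error history, which keeps the sum over clusters finite
  -- although space-time is infinite.
  set 𝒦 : Finset (Finset (STEdge L)) := Finset.univ.image Kf with h𝒦
  set 𝒞 : Fin T × Cell L → Finset (Finset (STEdge L)) := fun v =>
    𝒦.filter fun K => IsCluster ((v.1 : ℕ), v.2) K ∧ L ≤ K.card with h𝒞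
  have hprod : ∀ ω : Fin T → Edge L → Err, 0 ≤ ∏ k, ∏ b, (ω k b).prob p := fun ω =>
    Finset.prod_nonneg fun k _ => Finset.prod_nonneg fun b _ => Err.prob_nonneg h0 h1 _
  have hl0 : 0 < l := by linarith
  have hterm : ∀ ω : Fin T → Edge L → Err,
      (if Fails ω then ∏ k, ∏ b, (ω k b).prob p else 0) ≤
        ∑ v, ∑ K ∈ 𝒞 v, if K.card ≤ m * errorCount ω K then ∏ k, ∏ b, (ω k b).prob p else 0 := by
    intro ω
    have hnn : ∀ K : Finset (STEdge L),
        0 ≤ if K.card ≤ m * errorCount ω K then ∏ k, ∏ b, (ω k b).prob p else 0 := by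
      intro K
      split_ifs <;> [exact hprod ω; exact le_rfl]
    split_ifs with h
    · obtain ⟨k, x, hs⟩ := hKf ω h
      refine le_trans ?_ (Finset.single_le_sum
        (f := fun v => ∑ K ∈ 𝒞 v, if K.card ≤ m * errorCount ω K then
          ∏ k, ∏ b, (ω k b).prob p else 0)
        (fun v _ => Finset.sum_nonneg fun K _ => hnn K) (Finset.mem_univ (k, x)))
      refine le_trans ?_ (Finset.single_le_sum (fun K _ => hnn K)
        (show Kf ω ∈ 𝒞 (k, x) from Finset.mem_filter.2
          ⟨Finset.mem_image_of_mem _ (Finset.mem_univ _), hs.1, hs.2.1⟩))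
      rw [if_pos hs.2.2]
    · exact Finset.sum_nonneg fun v _ => Finset.sum_nonneg fun K _ => hnn K
  have hcl : ∀ v, ∑ K ∈ 𝒞 v, ((1 + 2 * p * l ^ m) / l) ^ K.card ≤ ρ ^ L := by
    intro v
    have hqq : 0 ≤ q * (1 - q) ^ 12 := mul_nonneg hq (pow_nonneg (by linarith) _)
    calc ∑ K ∈ 𝒞 v, ((1 + 2 * p * l ^ m) / l) ^ K.card
        ≤ ∑ K ∈ 𝒞 v, ρ ^ L * (q * (1 - q) ^ 12) ^ K.card := by
          refine Finset.sum_le_sum fun K hK => ?_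
          refine (pow_le_pow_left₀ (by positivity) hlq _).trans ?_
          rw [mul_pow]
          exact mul_le_mul_of_nonneg_right
            (pow_le_pow_of_le_one hρ hρ' (Finset.mem_filter.1 hK).2.2) (pow_nonneg hqq _)
      _ = ρ ^ L * ∑ K ∈ 𝒞 v, (q * (1 - q) ^ 12) ^ K.card := by rw [Finset.mul_sum]
      _ ≤ ρ ^ L * 1 := by
          refine mul_le_mul_of_nonneg_left ?_ (pow_nonneg hρ _)
          exact sum_cluster_le_one _ _ (fun K hK => (Finset.mem_filter.1 hK).2.1) hq hq'
      _ = ρ ^ L := mul_one _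
  calc failureProb L T p
      ≤ ∑ ω : Fin T → Edge L → Err, ∑ v, ∑ K ∈ 𝒞 v,
          if K.card ≤ m * errorCount ω K then ∏ k, ∏ b, (ω k b).prob p else 0 :=
        Finset.sum_le_sum fun ω _ => hterm ω
    _ = ∑ v, ∑ K ∈ 𝒞 v, ∑ ω : Fin T → Edge L → Err,
          if K.card ≤ m * errorCount ω K then ∏ k, ∏ b, (ω k b).prob p else 0 := by
        rw [Finset.sum_comm]
        exact Finset.sum_congr rfl fun v _ => Finset.sum_comm
    _ ≤ ∑ v : Fin T × Cell L, ρ ^ L :=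
        Finset.sum_le_sum fun v _ => (Finset.sum_le_sum fun K _ =>
          prob_errorCount_le h0 h1 hl m K).trans (hcl v)
    _ = T * (L ^ 2 * ρ ^ L) := by
        rw [Finset.sum_const, Finset.card_univ]
        simp [ZMod.card]
        ring

end Probability

end Clusters

/-! ### Joining strings at common end points -/

section Matching

variable {V α : Type}

/-- A point that occurs twice is either both ends of one string, which can be dropped, or a common
end of two strings, which can be joined. -/
theorem exists_common_end_of_not_nodup (ends : α → Multiset V)
    (hends : ∀ l, ∃ u v, ends l = {u, v}) (Q : Multiset α) (hQ : ¬ (Q.bind ends).Nodup) :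
    (∃ l u Q', Q = l ::ₘ Q' ∧ ends l = {u, u}) ∨
      ∃ l l' u v x Q', Q = l ::ₘ l' ::ₘ Q' ∧ ends l = {u, v} ∧ ends l' = {v, x} := by
  induction Q using Multiset.induction with
  | empty => simp at hQ
  | cons l Q ih =>
    by_cases h : (Q.bind ends).Nodup
    · rw [Multiset.cons_bind, Multiset.nodup_add] at hQ
      obtain ⟨u, v, huv⟩ := hends l
      by_cases huv' : u = v
      · subst huv'
        exact Or.inl ⟨l, u, Q, rfl, huv⟩
      · right
        have hn : (ends l).Nodup := by
          rw [huv]; simp [huv']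
        have hd : ¬ Disjoint (ends l) (Q.bind ends) := fun hd => hQ ⟨hn, h, hd⟩
        rw [Multiset.disjoint_left] at hd
        push Not at hd
        obtain ⟨x, hx, hxQ⟩ := hd
        obtain ⟨l', hl', hxl'⟩ := Multiset.mem_bind.1 hxQ
        obtain ⟨Q', rfl⟩ := Multiset.exists_cons_of_mem hl'
        have key : ∀ l, x ∈ ends l → ∃ y, ends l = {x, y} := by
          intro l hl
          obtain ⟨a, b, hab⟩ := hends l
          rw [hab] at hl
          simp only [Multiset.insert_eq_cons, Multiset.mem_cons, Multiset.mem_singleton] at hl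
          rcases hl with rfl | rfl
          · exact ⟨b, hab⟩
          · exact ⟨a, hab.trans (Multiset.pair_comm _ _)⟩
        obtain ⟨y, hy⟩ := key l hx
        obtain ⟨z, hz⟩ := key l' hxl'
        exact ⟨l, l', y, x, z, Q', rfl, hy.trans (Multiset.pair_comm _ _), hz⟩
    · rcases ih h with ⟨l', u, Q', rfl, hu⟩ | ⟨l₁, l₂, u, v, x, Q', rfl, h₁, h₂⟩
      · exact Or.inl ⟨l', u, l ::ₘ Q', Multiset.cons_swap _ _ _, hu⟩
      · refine Or.inr ⟨l₁, l₂, u, v, x, l ::ₘ Q', ?_, h₁, h₂⟩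
        rw [Multiset.cons_swap, Multiset.cons_swap l l₂]

/-- Each join or drop removes one string, so the process terminates. It preserves the parity at
every point, since the ends that vanish coincide in pairs, and it does not increase the weight. The
abstract form serves both `Link` and `STLink`. -/
theorem exists_nodup_of_join [DecidableEq V] (ends : α → Multiset V) (weight : α → ℕ)
    (r : Multiset α → Multiset α → Prop) (hends : ∀ l, ∃ u v, ends l = {u, v})
    (join : ∀ l l' u v x Q, ends l = {u, v} → ends l' = {v, x} →
      ∃ l'', ends l'' = {u, x} ∧ weight l'' ≤ weight l + weight l' ∧
        r (l ::ₘ l' ::ₘ Q) (l'' ::ₘ Q))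
    (drop : ∀ l u Q, ends l = {u, u} → r (l ::ₘ Q) Q) (Q : Multiset α) :
    ∃ Q', Relation.ReflTransGen r Q Q' ∧ (Q'.bind ends).Nodup ∧
      (∀ x, (((Q'.bind ends).count x : ℕ) : ZMod 2) = (Q.bind ends).count x) ∧
      (Q'.map weight).sum ≤ (Q.map weight).sum := by
  induction hn : Q.card using Nat.strong_induction_on generalizing Q with
  | _ n ih =>
    by_cases hQ : (Q.bind ends).Nodup
    · exact ⟨Q, .refl, hQ, fun _ => rfl, le_rfl⟩
    · have two : ∀ a : ZMod 2, a + a = 0 := by decide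
      rcases exists_common_end_of_not_nodup ends hends Q hQ with
        ⟨l, u, Q₁, rfl, hu⟩ | ⟨l, l', u, v, y, Q₁, rfl, h₁, h₂⟩
      · obtain ⟨Q', h1, h2, h3, h4⟩ := ih Q₁.card (by rw [← hn]; simp) Q₁ rfl
        refine ⟨Q', .head (drop l u Q₁ hu) h1, h2, fun x => ?_, ?_⟩
        · rw [h3, Multiset.cons_bind, hu]
          simp only [Multiset.insert_eq_cons, Multiset.count_add, Multiset.count_cons,
            Multiset.count_singleton]
          push_cast
          rw [two, zero_add]
        · rw [Multiset.map_cons, Multiset.sum_cons]; omega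
      · obtain ⟨l'', e, hw, hr⟩ := join l l' u v y Q₁ h₁ h₂
        obtain ⟨Q', h1, h2, h3, h4⟩ := ih (l'' ::ₘ Q₁).card (by rw [← hn]; simp) (l'' ::ₘ Q₁) rfl
        refine ⟨Q', .head hr h1, h2, fun x => ?_, ?_⟩
        · rw [h3, Multiset.cons_bind, Multiset.cons_bind, Multiset.cons_bind, e, h₁, h₂]
          simp only [Multiset.insert_eq_cons, Multiset.count_add, Multiset.count_cons,
            Multiset.count_singleton]
          push_cast
          linear_combination -(two (if x = v then 1 else 0))
        · simp only [Multiset.map_cons, Multiset.sum_cons] at h4 ⊢; omega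

/-! ### Parity, existence and local minimality of matchings -/

theorem isMatching_parity [DecidableEq V] {ends : α → Multiset V} {M : Multiset α} {D : Set V}
    (h : IsMatching ends D M) (x : V) :
    (((M.bind ends).count x : ℕ) : ZMod 2) = 1 ↔ x ∈ D := by
  rw [← h.2 x]
  by_cases hx : x ∈ M.bind ends
  · simp [Multiset.count_eq_one_of_mem h.1 hx, hx]
  · simp [hx]

theorem isMatching_of_nodup [DecidableEq V] {ends : α → Multiset V} {M : Multiset α}
    (h : (M.bind ends).Nodup) :
    IsMatching ends {x | (((M.bind ends).count x : ℕ) : ZMod 2) = 1} M :=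
  ⟨h, fun x => (isMatching_parity (D := {x | x ∈ M.bind ends}) ⟨h, fun _ => Iff.rfl⟩ x).symm⟩

theorem exists_isMWPM {ends : α → Multiset V} (weight : α → ℕ) {D : Set V} {M : Multiset α}
    (h : IsMatching ends D M) : ∃ M', IsMWPM ends weight D M' := by
  classical
  have hex : ∃ n, ∃ M, IsMatching ends D M ∧ (M.map weight).sum = n := ⟨_, M, h, rfl⟩
  obtain ⟨M', h1, h2⟩ := Nat.find_spec hex
  exact ⟨M', h1, fun N hN => h2 ▸ Nat.find_min' hex ⟨N, hN, rfl⟩⟩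

theorem sum_map_ite_eq_filter (p : α → Prop) [DecidablePred p] (w : α → ℕ) (M : Multiset α) :
    (M.map fun l => if p l then w l else 0).sum = ((M.filter p).map w).sum := by
  induction M using Multiset.induction with
  | empty => simp
  | cons l M ih => by_cases h : p l <;> simp [h, ih]

/-- A minimum-weight perfect matching is minimal in every region that its strings do not leave. -/
theorem IsMWPM.sum_le_of_region {ends : α → Multiset V} {weight : α → ℕ} {D : Set V}
    {M N : Multiset α} (h : IsMWPM ends weight D M) (p : α → Prop) [DecidablePred p] (C : V → Prop)
    (hp : ∀ l ∈ M, ∀ v ∈ ends l, (C v ↔ p l)) (hN : IsMatching ends {v | v ∈ D ∧ C v} N) :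
    (M.map fun l => if p l then weight l else 0).sum ≤ (N.map weight).sum := by
  have hM : M.filter p + M.filter (fun l => ¬ p l) = M := Multiset.filter_add_not p M
  have hmem : ∀ v, v ∈ (M.filter (fun l => ¬ p l)).bind ends ↔ v ∈ D ∧ ¬ C v := by
    intro v
    rw [← h.1.2 v]
    simp only [Multiset.mem_bind, Multiset.mem_filter]
    constructor
    · rintro ⟨l, ⟨hl, hpl⟩, hv⟩
      exact ⟨⟨l, hl, hv⟩, fun hC => hpl ((hp l hl v hv).1 hC)⟩
    · rintro ⟨⟨l, hl, hv⟩, hC⟩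
      exact ⟨l, ⟨hl, fun hpl => hC ((hp l hl v hv).2 hpl)⟩, hv⟩
  -- Exchange argument: the strings of `M` inside the region are replaced by `N`.
  have hmatch : IsMatching ends D (N + M.filter (fun l => ¬ p l)) := by
    refine ⟨?_, fun v => ?_⟩
    · rw [Multiset.add_bind, Multiset.nodup_add]
      refine ⟨hN.1, ?_, ?_⟩
      · have := h.1.1
        rw [← hM, Multiset.add_bind, Multiset.nodup_add] at this
        exact this.2.1
      · rw [Multiset.disjoint_left]
        intro v hv hv'
        exact ((hmem v).1 hv').2 ((hN.2 v).1 hv).2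
    · rw [Multiset.add_bind, Multiset.mem_add, hN.2 v, hmem v]
      simp only [Set.mem_ofPred_eq]
      tauto
  have := h.2 _ hmatch
  conv_lhs at this => rw [← hM]
  rw [Multiset.map_add, Multiset.map_add, Multiset.sum_add, Multiset.sum_add] at this
  rw [sum_map_ite_eq_filter]
  omega

/-- Matching the boundary of a finite set of edges. -/
theorem exists_isMatching_boundary [DecidableEq V] {β : Type} (ends : α → Multiset V)
    (weight : α → ℕ) (hends : ∀ l, ∃ u v, ends l = {u, v})
    (join : ∀ l l' u v x, ends l = {u, v} → ends l' = {v, x} →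
      ∃ l'', ends l'' = {u, x} ∧ weight l'' ≤ weight l + weight l')
    (A : Finset β) (mk : β → α) (s t : β → V) (hmk : ∀ b, ends (mk b) = {s b, t b})
    (hw : ∀ b, weight (mk b) ≤ 1) :
    ∃ M, IsMatching ends
      {x | ∑ b ∈ A, ((if s b = x then 1 else 0) + (if t b = x then 1 else 0) : ZMod 2) = 1} M ∧
      (M.map weight).sum ≤ A.card := by
  -- One string per edge, joined as far as possible. Only end points and weights matter, so the
  -- relation between successive stages is trivial.
  obtain ⟨M, -, h1, h2, h3⟩ := exists_nodup_of_join ends weight (fun _ _ => True) hends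
    (fun l l' u v x _ h h' => (join l l' u v x h h').imp fun _ h => ⟨h.1, h.2, trivial⟩)
    (fun _ _ _ _ => trivial) (A.val.map mk)
  have hcount : ∀ (B : Multiset β) x, ((((B.map mk).bind ends).count x : ℕ) : ZMod 2) =
      (B.map fun b =>
        ((if s b = x then 1 else 0) + (if t b = x then 1 else 0) : ZMod 2)).sum := by
    intro B x
    induction B using Multiset.induction with
    | empty => simp
    | cons b B ih =>
      simp only [Multiset.map_cons, Multiset.cons_bind, Multiset.count_add, Multiset.sum_cons,
        hmk, Nat.cast_add, ih]
      simp only [Multiset.insert_eq_cons, Multiset.count_cons, Multiset.count_singleton,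
        eq_comm (a := x)]
      push_cast
      ring
  refine ⟨M, ?_, h3.trans ?_⟩
  · have := isMatching_of_nodup h1
    simp only [h2, hcount] at this
    exact this
  · rw [Multiset.map_map]
    have : ∀ B : Multiset β, (B.map (weight ∘ mk)).sum ≤ B.card := by
      intro B
      induction B using Multiset.induction with
      | empty => simp
      | cons b B ih =>
        have := hw b
        simp only [Multiset.map_cons, Multiset.sum_cons, Multiset.card_cons, Function.comp]
        simp only [Function.comp_def] at ih
        omega
    exact this A.val

end Matching

/-! ### Displacements and the Manhattan length -/

theorem toCell_add (L : ℕ) (v w : Disp) : toCell L (v + w) = toCell L v + toCell L w := by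
  funext d; simp [toCell]

theorem toCell_neg (L : ℕ) (v : Disp) : toCell L (-v) = -toCell L v := by
  funext d; simp [toCell]

theorem toCell_sub (L : ℕ) (v w : Disp) : toCell L (v - w) = toCell L v - toCell L w := by
  funext d; simp [toCell]

theorem toCell_zero (L : ℕ) : toCell L 0 = 0 := by
  funext d; simp [toCell]

theorem toCell_single (L : ℕ) (d : Fin 2) :
    toCell L (Pi.single d 1) = (Pi.single d 1 : Cell L) := by
  funext d'; by_cases h : d' = d
  · subst h; simp [toCell]
  · simp [toCell, h]

theorem l1_add_le (v w : Disp) : l1 (v + w) ≤ l1 v + l1 w := by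
  simp only [l1, ← Finset.sum_add_distrib]
  exact Finset.sum_le_sum fun d _ => Int.natAbs_add_le _ _

theorem l1_neg (v : Disp) : l1 (-v) = l1 v := by simp [l1]

theorem l1_single (d : Fin 2) : l1 (Pi.single d 1) = 1 := by
  fin_cases d <;> simp [l1, Fin.sum_univ_two]

theorem l1_eq_zero {v : Disp} (h : l1 v = 0) : v = 0 := by
  funext d
  simpa using (Finset.sum_eq_zero_iff.1 h) d (Finset.mem_univ d)

/-! ### Orienting and joining strings on the torus and in space-time -/

section Links

variable {L : ℕ}

theorem Link.reverse_tgt (l : Link L) : l.reverse.tgt = l.src := by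
  simp [Link.reverse, Link.tgt, toCell_neg]

theorem pair_eq_pair_iff {V : Type} {a b c d : V} :
    ({a, b} : Multiset V) = {c, d} ↔ (a = c ∧ b = d) ∨ (a = d ∧ b = c) := by
  classical
  constructor
  · intro h
    simp only [Multiset.insert_eq_cons, Multiset.cons_eq_cons, Multiset.singleton_eq_cons_iff] at h
    rcases h with ⟨rfl, h⟩ | ⟨_, cs, h1, h2⟩
    · exact Or.inl ⟨rfl, by simpa using h⟩
    · right
      have e1 : b = c ∧ cs = 0 := by
        simpa [eq_comm] using h1
      have e2 : d = a ∧ cs = 0 := by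
        simpa [eq_comm] using h2
      exact ⟨e2.1.symm, e1.1⟩
  · rintro (⟨rfl, rfl⟩ | ⟨rfl, rfl⟩)
    · rfl
    · exact Multiset.pair_comm _ _

/-- `ends` forgets the orientation, whereas `Reconnect.join` needs it; one flip restores it if
necessary. -/
theorem Link.exists_oriented {l : Link L} {u v : Cell L} (h : l.ends = {u, v}) :
    ∃ l' : Link L, l'.src = u ∧ l'.tgt = v ∧ l'.len = l.len ∧
      ∀ Q, Relation.ReflTransGen Reconnect (l ::ₘ Q) (l' ::ₘ Q) := by
  rcases pair_eq_pair_iff.1 h with ⟨h1, h2⟩ | ⟨h1, h2⟩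
  · exact ⟨l, h1, h2, rfl, fun Q => .refl⟩
  · exact ⟨l.reverse, h2, (Link.reverse_tgt l).trans h1, l1_neg _, fun Q => .single (.flip l Q)⟩

theorem Link.exists_join {l l' : Link L} {u v x : Cell L} (h : l.ends = {u, v})
    (h' : l'.ends = {v, x}) :
    ∃ l'' : Link L, l''.ends = {u, x} ∧ l''.len ≤ l.len + l'.len ∧
      ∀ Q, Relation.ReflTransGen Reconnect (l ::ₘ l' ::ₘ Q) (l'' ::ₘ Q) := by
  obtain ⟨k, h1, h2, h3, h4⟩ := Link.exists_oriented h
  obtain ⟨k', h1', h2', h3', h4'⟩ := Link.exists_oriented h'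
  have ht : (⟨k.src, k.disp + k'.disp⟩ : Link L).tgt = x := by
    rw [← h2']
    simp only [Link.tgt] at h2 ⊢
    rw [toCell_add, ← add_assoc, h2, h1']
  refine ⟨⟨k.src, k.disp + k'.disp⟩, ?_, ?_, fun Q => ?_⟩
  · rw [Link.ends, ht, h1]
  · rw [← h3, ← h3']
    exact l1_add_le _ _
  · refine (h4 _).trans ?_
    rw [Multiset.cons_swap]
    refine (h4' _).trans ?_
    rw [Multiset.cons_swap]
    exact .single (.join k k' Q (h2.trans h1'.symm))

theorem Reconnect.exists_nodup (Q : Multiset (Link L)) :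
    ∃ Q', Relation.ReflTransGen Reconnect Q Q' ∧ (Q'.bind Link.ends).Nodup ∧
      (∀ x, (((Q'.bind Link.ends).count x : ℕ) : ZMod 2) = (Q.bind Link.ends).count x) ∧
      (Q'.map Link.len).sum ≤ (Q.map Link.len).sum := by
  -- The closure of `Reconnect` is used as the basic relation because a join may require flips
  -- first.
  have := exists_nodup_of_join Link.ends Link.len (Relation.ReflTransGen (Reconnect (L := L)))
    (fun l => ⟨l.src, l.tgt, rfl⟩)
    (fun l l' u v x Q h h' => by
      obtain ⟨l'', h1, h2, h3⟩ := Link.exists_join h h'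
      exact ⟨l'', h1, h2, h3 Q⟩)
    (fun l u Q h => .single (.drop l Q (by
      rcases pair_eq_pair_iff.1 h with ⟨h1, h2⟩ | ⟨h1, h2⟩ <;> rw [h1, h2]))) Q
  rwa [Relation.reflTransGen_eq_self] at this

/-- The final point of a space-time string. -/
def STLink.tgt (l : STLink L) : ℕ × Cell L := (l.time, l.src.2 + toCell L l.disp)

theorem STLink.exists_oriented {l : STLink L} {u v : ℕ × Cell L} (h : l.ends = {u, v}) :
    ∃ l' : STLink L, l'.src = u ∧ l'.tgt = v ∧ l'.len = l.len := by
  rcases pair_eq_pair_iff.1 h with ⟨h1, h2⟩ | ⟨h1, h2⟩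
  · exact ⟨l, h1, h2, rfl⟩
  · refine ⟨⟨u, v.1, -l.disp⟩, rfl, ?_, ?_⟩
    · subst h1; subst h2
      simp [STLink.tgt, toCell_neg]
    · subst h1; subst h2
      simp [STLink.len, l1_neg, Nat.dist_comm]

theorem STLink.exists_join {l l' : STLink L} {u v x : ℕ × Cell L} (h : l.ends = {u, v})
    (h' : l'.ends = {v, x}) :
    ∃ l'' : STLink L, l''.ends = {u, x} ∧ l''.len ≤ l.len + l'.len := by
  obtain ⟨k, h1, h2, h3⟩ := STLink.exists_oriented h
  obtain ⟨k', h1', h2', h3'⟩ := STLink.exists_oriented h'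
  subst h1; subst h2; subst h2'
  refine ⟨⟨k.src, k'.time, k.disp + k'.disp⟩, ?_, ?_⟩
  · simp only [STLink.ends, STLink.tgt, toCell_add, h1', add_assoc]
  · rw [← h3, ← h3']
    have h4 : k'.src.1 = k.time := by rw [h1']; rfl
    have := Nat.dist.triangle_inequality k.src.1 k.time k'.time
    have := l1_add_le k.disp k'.disp
    simp only [STLink.len, h4]
    omega

end Links

/-! ### Paths in the universal cover -/

section Lift

variable {L : ℕ}

/-- The final vertex of an edge in the universal cover. -/
def liftStep (v : ℕ × Disp) : Option (Fin 2) → ℕ × Disp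
  | none => (v.1 + 1, v.2)
  | some d => (v.1, v.2 + Pi.single d 1)

/-- The covering map. -/
def proj (L : ℕ) (v : ℕ × Disp) : STVertex L := (v.1, toCell L v.2)

theorem stTgt_proj (v : ℕ × Disp) (o : Option (Fin 2)) :
    stTgt (proj L v, o) = proj L (liftStep v o) := by
  cases o <;> simp [stTgt, proj, liftStep, toCell_add, toCell_single]

/-- Two vertices of the universal cover are joined by lifts of edges of `U`. -/
def LiftJoined (U : Finset (STEdge L)) : ℕ × Disp → ℕ × Disp → Prop :=
  Relation.EqvGen fun v w => ∃ o, (proj L v, o) ∈ U ∧ w = liftStep v o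

theorem LiftJoined.of_mem {U : Finset (STEdge L)} {v : ℕ × Disp} {o : Option (Fin 2)}
    (h : (proj L v, o) ∈ U) : LiftJoined U v (liftStep v o) := .rel _ _ ⟨o, h, rfl⟩

theorem LiftJoined.mono {U U' : Finset (STEdge L)} (hU : U ⊆ U') {v w : ℕ × Disp}
    (h : LiftJoined U v w) : LiftJoined U' v w :=
  Relation.EqvGen.mono (fun _ _ ⟨o, ho, hw⟩ => ⟨o, hU ho, hw⟩) _ _ h

theorem Joined.mono {U U' : Finset (STEdge L)} (hU : U ⊆ U') {v w : STVertex L}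
    (h : Joined U v w) : Joined U' v w :=
  Relation.EqvGen.mono (fun _ _ ⟨o, ho, hw⟩ => ⟨o, hU ho, hw⟩) _ _ h

theorem LiftJoined.joined {U : Finset (STEdge L)} {v w : ℕ × Disp} (h : LiftJoined U v w) :
    Joined U (proj L v) (proj L w) := by
  induction h with
  | rel v w h =>
    obtain ⟨o, ho, rfl⟩ := h
    rw [← stTgt_proj]
    exact .of_mem ho
  | refl => exact .refl _
  | symm _ _ _ ih => exact .symm _ _ ih
  | trans _ _ _ _ _ ih ih' => exact .trans _ _ _ ih ih'

theorem exists_dir_toward {v : Disp} (h : l1 v ≠ 0) : ∃ s : Dir, l1 (v - s.vec) + 1 = l1 v := by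
  have : v 0 ≠ 0 ∨ v 1 ≠ 0 := by
    by_contra hcon
    push Not at hcon
    exact h (by simp [l1, Fin.sum_univ_two, hcon])
  simp only [l1, Fin.sum_univ_two, Pi.sub_apply, Dir.vec]
  rcases this with h | h
  · rcases lt_or_gt_of_ne h with h | h
    · exact ⟨(0, false), by simp; omega⟩
    · exact ⟨(0, true), by simp; omega⟩
  · rcases lt_or_gt_of_ne h with h | h
    · exact ⟨(1, false), by simp; omega⟩
    · exact ⟨(1, true), by simp; omega⟩

/-- The edges of a shortest path. -/
theorem exists_path (L : ℕ) (v w : ℕ × Disp) : ∃ P : Finset (STEdge L),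
    P.card ≤ Nat.dist v.1 w.1 + l1 (w.2 - v.2) ∧ LiftJoined P v w ∧
      ∀ e ∈ P, Joined P (proj L v) e.1 := by
  -- Prepending one edge, which may be traversed in either direction; hence it may start at `v` or
  -- at `v'`.
  have key : ∀ (v v' : ℕ × Disp) (e : STEdge L) (P : Finset (STEdge L)),
      LiftJoined {e} v v' → (e.1 = proj L v ∨ e.1 = proj L v') → LiftJoined P v' w →
      (∀ e ∈ P, Joined P (proj L v') e.1) →
      LiftJoined (insert e P) v w ∧ ∀ e' ∈ insert e P, Joined (insert e P) (proj L v) e'.1 := by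
    intro v v' e P h1 h2 h3 h4
    have h5 : LiftJoined (insert e P) v v' := h1.mono (by simp)
    refine ⟨h5.trans _ _ _ (h3.mono (Finset.subset_insert _ _)), fun e' he' => ?_⟩
    rcases Finset.mem_insert.1 he' with rfl | he'
    · rcases h2 with h2 | h2
      · rw [h2]; exact .refl _
      · rw [h2]; exact h5.joined
    · exact h5.joined.trans _ _ _ ((h4 e' he').mono (Finset.subset_insert _ _))
  induction hn : Nat.dist v.1 w.1 + l1 (w.2 - v.2) generalizing v with
  | zero =>
    have h1 : v.1 = w.1 := Nat.eq_of_dist_eq_zero (by omega)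
    have h2 : w.2 - v.2 = 0 := l1_eq_zero (by omega)
    have h3 : v = w := Prod.ext h1 (sub_eq_zero.1 h2).symm
    subst h3
    exact ⟨∅, by simp, .refl _, by simp⟩
  | succ n ih =>
    obtain ⟨v', e, hd, h1, h2⟩ : ∃ (v' : ℕ × Disp) (e : STEdge L),
        Nat.dist v'.1 w.1 + l1 (w.2 - v'.2) = n ∧ LiftJoined {e} v v' ∧
          (e.1 = proj L v ∨ e.1 = proj L v') := by
      -- The path first moves in time until the periods agree, and then in space.
      rcases lt_trichotomy v.1 w.1 with h | h | h
      · refine ⟨liftStep v none, (proj L v, none), ?_, .of_mem (by simp), Or.inl rfl⟩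
        simp only [liftStep, Nat.dist] at hn ⊢
        omega
      · obtain ⟨⟨d, b⟩, hs⟩ := exists_dir_toward (v := w.2 - v.2) (by
          simp only [Nat.dist] at hn
          omega)
        cases b with
        | true =>
          refine ⟨liftStep v (some d), (proj L v, some d), ?_, .of_mem (by simp), Or.inl rfl⟩
          have : w.2 - (v.2 + Pi.single d 1) = w.2 - v.2 - Dir.vec (d, true) := by
            simp [Dir.vec, sub_sub]
          simp only [liftStep, this]
          omega
        | false =>
          have hv : liftStep (v.1, v.2 - Pi.single d 1) (some d) = v := by simp [liftStep]
          refine ⟨(v.1, v.2 - Pi.single d 1), (proj L (v.1, v.2 - Pi.single d 1), some d), ?_, ?_,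
            Or.inr rfl⟩
          · have : w.2 - (v.2 - Pi.single d 1) = w.2 - v.2 - Dir.vec (d, false) := by
              simp only [Dir.vec, Bool.false_eq_true, if_false, Pi.single_neg]
              abel
            simp only [this]
            omega
          · have := LiftJoined.of_mem (L := L) (v := (v.1, v.2 - Pi.single d 1)) (o := some d)
              (Finset.mem_singleton_self _)
            rw [hv] at this
            exact this.symm _ _
      · have hv : liftStep (v.1 - 1, v.2) none = v := by
          simp only [liftStep]
          rw [Nat.sub_add_cancel (by omega)]
        refine ⟨(v.1 - 1, v.2), (proj L (v.1 - 1, v.2), none), ?_, ?_, Or.inr rfl⟩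
        · simp only [Nat.dist] at hn ⊢
          omega
        · have := LiftJoined.of_mem (L := L) (v := (v.1 - 1, v.2)) (o := none)
            (Finset.mem_singleton_self _)
          rw [hv] at this
          exact this.symm _ _
    obtain ⟨P, hP1, hP2, hP3⟩ := ih v' hd
    refine ⟨insert e P, (Finset.card_insert_le _ _).trans (by omega), key v v' e P h1 h2 hP2 hP3⟩

/-- The edges of a chosen shortest path. -/
noncomputable def pathEdges (L : ℕ) (v w : ℕ × Disp) : Finset (STEdge L) :=
  (exists_path L v w).choose

theorem card_pathEdges_le (v w : ℕ × Disp) :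
    (pathEdges L v w).card ≤ Nat.dist v.1 w.1 + l1 (w.2 - v.2) :=
  (exists_path L v w).choose_spec.1

theorem liftJoined_pathEdges (v w : ℕ × Disp) : LiftJoined (pathEdges L v w) v w :=
  (exists_path L v w).choose_spec.2.1

theorem joined_of_mem_pathEdges {v w : ℕ × Disp} {e : STEdge L} (h : e ∈ pathEdges L v w) :
    Joined (pathEdges L v w) (proj L v) e.1 :=
  (exists_path L v w).choose_spec.2.2 e h

/-! ### Sheets of the universal cover -/

/-- The lift of a cell to the fundamental domain. -/
def liftCell (x : Cell L) : Disp := fun d => ((x d).val : ℤ)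

theorem toCell_liftCell [NeZero L] (x : Cell L) : toCell L (liftCell x) = x := by
  funext d
  simp [toCell, liftCell]

theorem int_succ_ediv {a L : ℤ} (hL : 0 < L) (h : ¬ L ∣ a + 1) : (a + 1) / L = a / L := by
  have h1 := Int.emod_add_mul_ediv a L
  have h2 := Int.emod_nonneg a hL.ne'
  have h3 := Int.emod_lt_of_pos a hL
  have h4 : a % L + 1 ≠ L := fun h4 => h ⟨a / L + 1, by linear_combination h4 - h1⟩
  refine (Int.ediv_emod_unique hL (r := a % L + 1)).2 ⟨?_, ?_, ?_⟩ |>.1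
  · linear_combination h1
  · omega
  · omega

/-- If all connected components have less than `L` edges, the sheets of the universal cover can be
labelled consistently. -/
theorem exists_potential [NeZero L] (U : Finset (STEdge L)) [DecidableRel (Joined U)]
    (hU : ∀ v, (U.filter fun e => Joined U v e.1).card < L) (d : Fin 2) :
    ∃ s : STVertex L → ℤ, ∀ v w, LiftJoined U v w →
      w.2 d / L - s (proj L w) = v.2 d / L - s (proj L v) := by
  classical
  have hL : (0 : ℤ) < L := by exact_mod_cast NeZero.pos L
  set S : STVertex L → Set (ZMod L) := fun v =>
    {r | ∃ u, (u, some d) ∈ U ∧ Joined U v u ∧ u.2 d = r} with hS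
  -- A component with fewer than `L` edges cannot contain an edge of direction `d` at each of the
  -- `L` positions.
  have hmiss : ∀ v, ∃ r, r ∉ S v := by
    intro v
    by_contra hcon
    push Not at hcon
    have hsub : (Finset.univ : Finset (ZMod L)) ⊆
        (U.filter fun e => Joined U v e.1).image fun e => e.1.2 d := by
      intro r _
      obtain ⟨u, hu, hj, hr⟩ := hcon r
      exact Finset.mem_image.2 ⟨_, Finset.mem_filter.2 ⟨hu, hj⟩, hr⟩
    have h1 := (Finset.card_le_card hsub).trans Finset.card_image_le
    rw [Finset.card_univ, ZMod.card] at h1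
    exact absurd (hU v) (not_lt.2 h1)
  -- The choice depends on `S v` only, so the same cut is selected throughout a component.
  set κ : STVertex L → ZMod L := fun v => Classical.epsilon fun r => r ∉ S v with hκ
  have hκS : ∀ v, κ v ∉ S v := fun v => Classical.epsilon_spec (hmiss v)
  have hκJ : ∀ v w, Joined U v w → κ v = κ w := by
    intro v w h
    have : S v = S w := by
      ext r
      constructor
      · rintro ⟨u, h1, h2, h3⟩
        exact ⟨u, h1, (h.symm _ _).trans _ _ _ h2, h3⟩
      · rintro ⟨u, h1, h2, h3⟩
        exact ⟨u, h1, h.trans _ _ _ h2, h3⟩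
    simp only [hκ, this]
  -- The sheet number relative to the cut instead of the seam. The shift by one puts the jump on the
  -- edge from `κ` to `κ + 1`, which the component does not contain, so `g` is constant along lifts.
  set g : ℕ × Disp → ℤ := fun v => (v.2 d - ((κ (proj L v)).val : ℤ) - 1) / L with hg
  -- The difference of the two sheet numbers: `1` at positions up to `κ v`, and `0` beyond.
  refine ⟨fun v => -((((v.2 d).val : ℤ) - ((κ v).val : ℤ) - 1) / L), fun v w h => ?_⟩
  have hgs : ∀ v : ℕ × Disp, v.2 d / L -
      -(((((proj L v).2 d).val : ℤ) - ((κ (proj L v)).val : ℤ) - 1) / L) = g v := by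
    intro v
    have h1 : (((proj L v).2 d).val : ℤ) = v.2 d % L := by
      simp only [proj, toCell, ZMod.val_intCast]
    have h2 : v.2 d - ((κ (proj L v)).val : ℤ) - 1 =
        (v.2 d % L - ((κ (proj L v)).val : ℤ) - 1) + L * (v.2 d / L) := by
      have := Int.emod_add_mul_ediv (v.2 d) L
      linear_combination -this
    simp only [hg]
    rw [h1, h2, Int.add_mul_ediv_left _ _ hL.ne']
    ring
  rw [hgs, hgs]
  induction h with
  | rel v w h =>
    obtain ⟨o, ho, rfl⟩ := h
    have hk : κ (proj L v) = κ (proj L (liftStep v o)) := by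
      rw [← stTgt_proj]
      exact hκJ _ _ (.of_mem ho)
    simp only [hg, ← hk]
    match o, ho with
    | none, _ => rfl
    | some d', ho =>
      by_cases hd : d' = d
      · subst hd
        have : (liftStep v (some d')).2 d' - ((κ (proj L v)).val : ℤ) - 1 =
            v.2 d' - ((κ (proj L v)).val : ℤ) - 1 + 1 := by
          simp only [liftStep, Pi.add_apply, Pi.single_eq_same]
          ring
        rw [this]
        refine int_succ_ediv hL fun hdvd => hκS (proj L v) ⟨proj L v, ho, .refl _, ?_⟩
        rw [sub_add_cancel] at hdvd
        have h0 := (ZMod.intCast_zmod_eq_zero_iff_dvd _ L).2 hdvd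
        push_cast at h0
        rw [ZMod.natCast_zmod_val, sub_eq_zero] at h0
        exact h0
      · simp [liftStep, Ne.symm hd]
  | refl => rfl
  | symm _ _ _ ih => exact ih.symm
  | trans _ _ _ _ _ ih ih' => exact ih'.trans ih

/-- A connected component is a cluster. -/
theorem isCluster_component (U : Finset (STEdge L)) [DecidableRel (Joined U)] {v : STVertex L}
    {e : STEdge L} (he : e ∈ U) (hv : Joined U v e.1) :
    IsCluster e.1 (U.filter fun e => Joined U v e.1) := by
  set K := U.filter fun e => Joined U v e.1 with hK
  refine ⟨⟨e, Finset.mem_filter.2 ⟨he, hv⟩, rfl⟩, fun e' he' => ?_⟩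
  have h0 : Joined U e.1 e'.1 := (hv.symm _ _).trans _ _ _ (Finset.mem_filter.1 he').2
  have hKU : ∀ w, Joined K e.1 w → Joined U v w := fun w hw =>
    hv.trans _ _ _ (hw.mono (Finset.filter_subset _ _))
  -- A connecting path in `U` never leaves the component, so it is a path in `K`.
  have := h0.invariant (f := fun w => Joined K e.1 w) (fun e₁ he₁ => propext ⟨fun h => ?_, fun h => ?_⟩)
  · exact this.mp (.refl _)
  · exact h.trans _ _ _ (Joined.of_mem (Finset.mem_filter.2 ⟨he₁, hKU _ h⟩))
  · have h2 : Joined U v e₁.1 := (hKU _ h).trans _ _ _ ((Joined.of_mem he₁).symm _ _)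
    exact h.trans _ _ _ ((Joined.of_mem (Finset.mem_filter.2 ⟨he₁, h2⟩)).symm _ _)

end Lift

/-! ### Edges used by a run -/

section UnionOf

variable {α β : Type} [DecidableEq β]

/-- The union of a family of finite sets over a multiset. -/
def unionOf (M : Multiset α) (f : α → Finset β) : Finset β := (M.bind fun a => (f a).val).toFinset

theorem mem_unionOf {M : Multiset α} {f : α → Finset β} {b : β} :
    b ∈ unionOf M f ↔ ∃ a ∈ M, b ∈ f a := by
  simp [unionOf]

/-- Only members with `p` contribute edges inside `C`, and each contributes at most its weight. This
turns all edge counts in a region into sums over strings or motions. -/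
theorem card_unionOf_filter_le (M : Multiset α) (f : α → Finset β) (C : β → Prop) [DecidablePred C]
    (p : α → Prop) [DecidablePred p] (w : α → ℕ) (h : ∀ a ∈ M, ∀ b ∈ f a, C b → p a)
    (hw : ∀ a ∈ M, (f a).card ≤ w a) :
    ((unionOf M f).filter C).card ≤ (M.map fun a => if p a then w a else 0).sum := by
  induction M using Multiset.induction with
  | empty => simp [unionOf]
  | cons a M ih =>
    have hu : unionOf (a ::ₘ M) f = f a ∪ unionOf M f := by
      ext b; simp [mem_unionOf]
    rw [hu, Finset.filter_union, Multiset.map_cons, Multiset.sum_cons]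
    refine (Finset.card_union_le _ _).trans (add_le_add ?_ (ih
      (fun a ha => h a (Multiset.mem_cons_of_mem ha))
      fun a ha => hw a (Multiset.mem_cons_of_mem ha)))
    split_ifs with hp
    · exact (Finset.card_filter_le _ _).trans (hw a (Multiset.mem_cons_self a M))
    · rw [Nat.le_zero, Finset.card_eq_zero, Finset.filter_eq_empty_iff]
      exact fun b hb hC => hp (h a (Multiset.mem_cons_self a M) b hb hC)

theorem card_biUnion_filter_le (H : ℕ) (f : ℕ → Finset β) (C : β → Prop) [DecidablePred C] :
    (((Finset.range H).biUnion f).filter C).card ≤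
      ∑ t ∈ Finset.range H, ((f t).filter C).card := by
  rw [Finset.filter_biUnion]
  exact Finset.card_biUnion_le

end UnionOf

/-! ### Motion and reconnection of chains within a region -/

section Links

variable {L : ℕ}

theorem Dir.l1_vec (s : Dir) : l1 s.vec = 1 := by
  obtain ⟨d, b⟩ := s
  cases b <;> fin_cases d <;> simp [l1, Dir.vec, Fin.sum_univ_two]

/-- The motion follows a shortest path, so every move shortens the class by exactly one. This makes
chain length the budget that pays for moves. -/
theorem Advance.len_add_card {l l' : Link L} {ms : Multiset (Move L)} (h : Advance l l' ms) :
    l'.len + ms.card = l.len := by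
  cases h with
  | first s h =>
    have h0 : l1 0 = 0 := by simp [l1]
    simp [Link.len, h, Dir.l1_vec, h0]
  | second s h =>
    have h0 : l1 0 = 0 := by simp [l1]
    simp [Link.len, h, Dir.l1_vec, h0]
  | both s s' h => simpa [Link.len] using h

theorem Advance.card_pos {l l' : Link L} {ms : Multiset (Move L)} (h : Advance l l' ms) :
    1 ≤ ms.card := by
  cases h <;> simp

theorem Advance.mem_moves {l l' : Link L} {ms : Multiset (Move L)} (h : Advance l l' ms)
    {m : Move L} (hm : m ∈ ms) : m.1 = l.src ∨ m.1 = l.tgt := by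
  cases h with
  | first s h => rw [Multiset.mem_singleton] at hm; subst hm; exact Or.inl rfl
  | second s h => rw [Multiset.mem_singleton] at hm; subst hm; exact Or.inr rfl
  | both s s' h =>
    simp only [Multiset.insert_eq_cons, Multiset.mem_cons, Multiset.mem_singleton] at hm
    rcases hm with rfl | rfl
    · exact Or.inl rfl
    · exact Or.inr rfl

theorem Dir.vec_opp (s : Dir) : s.opp.vec = -s.vec := by
  obtain ⟨d, b⟩ := s
  cases b <;> simp [Dir.opp, Dir.vec, ← Pi.single_neg]

/-- Each new end point is an old end point or the destination of a move, and moves do not leave the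
region. -/
theorem Advance.region {l l' : Link L} {ms : Multiset (Move L)} (h : Advance l l' ms)
    {c : Cell L → Prop} (hm : ∀ m ∈ ms, (c m.1 ↔ c m.dest)) (hl : c l.src ↔ c l.tgt) :
    (c l'.src ↔ c l.src) ∧ (c l'.tgt ↔ c l.src) := by
  cases h with
  | first s h =>
    simp only [Link.tgt, toCell_zero, add_zero] at hl ⊢
    exact ⟨hl.symm, hl.symm⟩
  | second s h => simp [Link.tgt, toCell_zero]
  | both s s' h =>
    have h1 := hm (l.src, s) (by simp)
    have h2 := hm (l.tgt, s'.opp) (by simp)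
    have h3 : (⟨l.src + toCell L s.vec, l.disp - s.vec - s'.vec⟩ : Link L).tgt =
        Move.dest (l.tgt, s'.opp) := by
      simp only [Link.tgt, Move.dest, Dir.vec_opp, toCell_sub, toCell_neg]
      abel
    rw [h3, ← h2, ← hl]
    exact ⟨h1.symm, Iff.rfl⟩

open Classical in
/-- Total length of the strings in a region. -/
noncomputable def regionLen (c : Cell L → Prop) (Q : Multiset (Link L)) : ℕ :=
  (Q.map fun l => if c l.src then l.len else 0).sum

theorem regionLen_cons (c : Cell L → Prop) [DecidablePred c] (l : Link L) (Q : Multiset (Link L)) :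
    regionLen c (l ::ₘ Q) = (if c l.src then l.len else 0) + regionLen c Q := by
  simp [regionLen]

theorem regionLen_add (c : Cell L → Prop) (Q Q' : Multiset (Link L)) :
    regionLen c (Q + Q') = regionLen c Q + regionLen c Q' := by
  simp [regionLen]

/-- Strings that share an end point lie on the same side of the region, so the triangle inequality
applies to each side separately. -/
theorem Reconnect.region {Q Q' : Multiset (Link L)} (h : Relation.ReflTransGen Reconnect Q Q')
    {c : Cell L → Prop} (hQ : ∀ l ∈ Q, (c l.src ↔ c l.tgt)) :
    (∀ l ∈ Q', (c l.src ↔ c l.tgt)) ∧ regionLen c Q' ≤ regionLen c Q := by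
  classical
  induction h with
  | refl => exact ⟨hQ, le_rfl⟩
  | tail _ hr ih =>
    -- By transitivity, only the length change in the last step remains to be estimated.
    refine (fun ⟨h1, h2⟩ => ⟨h1, le_trans h2 ih.2⟩ : (_ ∧ _) → _) ?_
    have hQ := ih.1
    clear ih
    cases hr with
    | flip l Q =>
      rw [Multiset.forall_mem_cons] at hQ ⊢
      refine ⟨⟨?_, hQ.2⟩, ?_⟩
      · rw [Link.reverse_tgt]; exact hQ.1.symm
      · have h1 : l.reverse.len = l.len := l1_neg _
        have h2 : c l.reverse.src ↔ c l.src := hQ.1.symm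
        rw [regionLen_cons, regionLen_cons, h1]
        simp only [h2, le_refl]
    | join l l' Q h =>
      simp only [Multiset.forall_mem_cons] at hQ ⊢
      have ht : (⟨l.src, l.disp + l'.disp⟩ : Link L).tgt = l'.tgt := by
        simp only [Link.tgt] at h ⊢
        rw [toCell_add, ← add_assoc, h]
      have h1 : c l.src ↔ c l'.src := by rw [← h]; exact hQ.1
      refine ⟨⟨?_, hQ.2.2⟩, ?_⟩
      · rw [ht, ← hQ.2.1]; exact h1
      · have h2 : l1 (l.disp + l'.disp) ≤ l1 l.disp + l1 l'.disp := l1_add_le _ _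
        simp only [regionLen_cons, ← h1, Link.len]
        split_ifs <;> omega
    | drop l Q h =>
      rw [Multiset.forall_mem_cons] at hQ
      refine ⟨hQ.2, ?_⟩
      rw [regionLen_cons]
      exact Nat.le_add_left _ _

/-- The space-time edge of a move in period `t`. -/
def moveEdge (t : ℕ) (m : Move L) : STEdge L := ((t, m.edge.1), some m.edge.2)

/-- Edges are oriented in the positive direction, so a move in a negative direction starts at the
final vertex of its edge. -/
theorem moveEdge_invariant {β : Sort*} (f : STVertex L → β) (t : ℕ) (m : Move L)
    (h : f (moveEdge t m).1 = f (stTgt (moveEdge t m))) :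
    f (moveEdge t m).1 = f (t, m.1) ∧ f (t, m.1) = f (t, m.dest) := by
  obtain ⟨x, d, b⟩ := m
  cases b with
  | true =>
    have : stTgt (moveEdge t (x, d, true)) = (t, Move.dest (x, d, true)) := by
      simp [stTgt, moveEdge, Move.edge, Move.dest, Dir.vec, toCell_single]
    rw [this] at h
    exact ⟨rfl, h⟩
  | false =>
    have h1 : stTgt (moveEdge t (x, d, false)) = (t, x) := by
      simp [stTgt, moveEdge, Move.edge]
    have h2 : (moveEdge t (x, d, false)).1 = (t, Move.dest (x, d, false)) := by
      simp [moveEdge, Move.edge, Move.dest, Dir.vec, Pi.single_neg, toCell_neg, toCell_single,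
        sub_eq_add_neg]
    rw [h1] at h
    exact ⟨h, h.symm.trans (congrArg f h2)⟩

/-- The space-time edges of the periods before `H`. -/
def allEdges (L H : ℕ) [NeZero L] : Finset (STEdge L) :=
  (Finset.range H ×ˢ Finset.univ) ×ˢ Finset.univ

theorem mem_allEdges [NeZero L] {H : ℕ} {e : STEdge L} : e ∈ allEdges L H ↔ e.1.1 < H := by
  simp [allEdges]

end Links

namespace Run

variable {L : ℕ} [NeZero L] {err : ℕ → Edge L → Err} (R : Run err)

/-- Edges with an error event. -/
def errorEdges : Finset (STEdge L) :=
  (allEdges L R.horizon).filter fun e => ∃ d, e.2 = some d ∧ err e.1.1 (e.1.2, d) ≠ Err.none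

/-- Edges along which anyons are moved in period `t`. -/
def moveEdges (t : ℕ) : Finset (STEdge L) :=
  unionOf (R.motions t) fun n => (n.moves.map (moveEdge t)).toFinset

/-- Measurements that detect an anyon at the end of period `t`. -/
def waitEdges (t : ℕ) : Finset (STEdge L) :=
  unionOf (R.pairs (t + 1)) fun l => {((t, l.src), none), ((t, l.tgt), none)}

/-- Edges of the strings of the hypothesis about the anyonic errors in period `t`. -/
noncomputable def hypEdges (t : ℕ) : Finset (STEdge L) :=
  unionOf (R.hyp t) fun l => pathEdges L (t, liftCell l.src) (t, liftCell l.src + l.disp)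

/-- Edges of the strings of the fermionic matching. -/
noncomputable def fermiEdges : Finset (STEdge L) :=
  unionOf R.fermi fun l =>
    pathEdges L (l.src.1, liftCell l.src.2) (l.time, liftCell l.src.2 + l.disp)

/-- All edges used by a run. -/
noncomputable def edges : Finset (STEdge L) :=
  R.errorEdges ∪ (Finset.range R.horizon).biUnion R.moveEdges ∪
    (Finset.range R.horizon).biUnion R.waitEdges ∪
    (Finset.range R.horizon).biUnion R.hypEdges ∪ R.fermiEdges

theorem errorEdges_subset : R.errorEdges ⊆ R.edges := fun e he => by
  simp only [edges, Finset.mem_union]; tauto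

theorem mem_edges_of_move {t : ℕ} (ht : t < R.horizon) {e : STEdge L} (he : e ∈ R.moveEdges t) :
    e ∈ R.edges := by
  have : e ∈ (Finset.range R.horizon).biUnion R.moveEdges :=
    Finset.mem_biUnion.2 ⟨t, Finset.mem_range.2 ht, he⟩
  simp only [edges, Finset.mem_union]; tauto

theorem mem_edges_of_wait {t : ℕ} (ht : t < R.horizon) {e : STEdge L} (he : e ∈ R.waitEdges t) :
    e ∈ R.edges := by
  have : e ∈ (Finset.range R.horizon).biUnion R.waitEdges :=
    Finset.mem_biUnion.2 ⟨t, Finset.mem_range.2 ht, he⟩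
  simp only [edges, Finset.mem_union]; tauto

theorem hypEdges_subset {t : ℕ} (ht : t < R.horizon) : R.hypEdges t ⊆ R.edges := fun e he => by
  have : e ∈ (Finset.range R.horizon).biUnion R.hypEdges :=
    Finset.mem_biUnion.2 ⟨t, Finset.mem_range.2 ht, he⟩
  simp only [edges, Finset.mem_union]; tauto

theorem fermiEdges_subset : R.fermiEdges ⊆ R.edges := fun e he => by
  simp only [edges, Finset.mem_union]; tauto

omit [NeZero L] in
theorem mem_moveEdges {t : ℕ} {n : Motion L} (hn : n ∈ R.motions t) {m : Move L}
    (hm : m ∈ n.moves) : moveEdge t m ∈ R.moveEdges t :=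
  mem_unionOf.2 ⟨n, hn, by
    rw [Multiset.mem_toFinset]; exact Multiset.mem_map_of_mem _ hm⟩

omit [NeZero L] in
theorem mem_waitEdges {t : ℕ} {l : Link L} (hl : l ∈ R.pairs (t + 1)) {x : Cell L}
    (hx : x ∈ l.ends) : (((t, x), none) : STEdge L) ∈ R.waitEdges t := by
  refine mem_unionOf.2 ⟨l, hl, ?_⟩
  simp only [Link.ends, Multiset.insert_eq_cons, Multiset.mem_cons, Multiset.mem_singleton] at hx
  rcases hx with rfl | rfl <;> simp

theorem pathEdges_subset_hyp {t : ℕ} (ht : t < R.horizon) {l : Link L} (hl : l ∈ R.hyp t) :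
    pathEdges L (t, liftCell l.src) (t, liftCell l.src + l.disp) ⊆ R.edges :=
  fun _ he => R.hypEdges_subset ht (mem_unionOf.2 ⟨l, hl, he⟩)

theorem pathEdges_subset_fermi {l : STLink L} (hl : l ∈ R.fermi) :
    pathEdges L (l.src.1, liftCell l.src.2) (l.time, liftCell l.src.2 + l.disp) ⊆ R.edges :=
  fun _ he => R.fermiEdges_subset (mem_unionOf.2 ⟨l, hl, he⟩)

theorem liftJoined_hyp {t : ℕ} (ht : t < R.horizon) {l : Link L} (hl : l ∈ R.hyp t) :
    LiftJoined R.edges (t, liftCell l.src) (t, liftCell l.src + l.disp) :=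
  (liftJoined_pathEdges _ _).mono (R.pathEdges_subset_hyp ht hl)

theorem liftJoined_fermi {l : STLink L} (hl : l ∈ R.fermi) :
    LiftJoined R.edges (l.src.1, liftCell l.src.2) (l.time, liftCell l.src.2 + l.disp) :=
  (liftJoined_pathEdges _ _).mono (R.pathEdges_subset_fermi hl)

/-! ### Size of a region that is a union of connected components -/

section Region

variable {C : STVertex L → Prop} (hC : ∀ e ∈ R.edges, C e.1 = C (stTgt e))

include hC

theorem region_hyp {t : ℕ} (ht : t < R.horizon) {l : Link L} (hl : l ∈ R.hyp t) :
    C (t, l.src) ↔ C (t, l.tgt) := by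
  have := (R.liftJoined_hyp ht hl).joined.invariant hC
  simp only [proj, toCell_add, toCell_liftCell] at this
  exact iff_of_eq this

theorem region_fermi {l : STLink L} (hl : l ∈ R.fermi) : C l.src ↔ C l.tgt := by
  have := (R.liftJoined_fermi hl).joined.invariant hC
  simp only [proj, toCell_add, toCell_liftCell] at this
  exact iff_of_eq this

theorem region_wait {t : ℕ} (ht : t < R.horizon) {l : Link L} (hl : l ∈ R.pairs (t + 1))
    {x : Cell L} (hx : x ∈ l.ends) : C (t, x) ↔ C (t + 1, x) :=
  iff_of_eq (hC _ (R.mem_edges_of_wait ht (R.mem_waitEdges hl hx)))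

theorem region_move {t : ℕ} (ht : t < R.horizon) {n : Motion L} (hn : n ∈ R.motions t)
    {m : Move L} (hm : m ∈ n.moves) :
    (C (moveEdge t m).1 ↔ C (t, m.1)) ∧ (C (t, m.1) ↔ C (t, m.dest)) := by
  have := moveEdge_invariant C t m (hC _ (R.mem_edges_of_move ht (R.mem_moveEdges hn hm)))
  exact ⟨iff_of_eq this.1, iff_of_eq this.2⟩

theorem region_after {t : ℕ} (ht : t < R.horizon)
    (h : ∀ l ∈ R.pairs t, (C (t, l.src) ↔ C (t, l.tgt))) {n : Motion L} (hn : n ∈ R.motions t) :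
    (C (t, n.after.src) ↔ C (t, n.before.src)) ∧ (C (t, n.after.tgt) ↔ C (t, n.before.src)) := by
  have hb : n.before ∈ R.pairs t := by
    rw [← R.motions_before t ht]
    exact Multiset.mem_map_of_mem _ hn
  exact n.valid.region (c := fun x => C (t, x)) (fun m hm => (R.region_move hC ht hn hm).2)
    (h _ hb)

theorem region_before_reconnect {t : ℕ} (ht : t < R.horizon)
    (h : ∀ l ∈ R.pairs t, (C (t, l.src) ↔ C (t, l.tgt))) :
    ∀ l ∈ (R.motions t).map Motion.after + R.hyp t, (C (t, l.src) ↔ C (t, l.tgt)) := by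
  intro l hl
  rcases Multiset.mem_add.1 hl with hl | hl
  · obtain ⟨n, hn, rfl⟩ := Multiset.mem_map.1 hl
    have := R.region_after hC ht h hn
    exact this.1.trans this.2.symm
  · exact R.region_hyp hC ht hl

/-- The chains themselves are not part of `Run.edges`. That both ends of a chain lie in the same
components follows by induction: motion and joining preserve it in layer `t`, and the detections at
both ends carry it to layer `t + 1`. -/
theorem region_pairs {t : ℕ} (ht : t ≤ R.horizon) :
    ∀ l ∈ R.pairs t, (C (t, l.src) ↔ C (t, l.tgt)) := by
  induction t with
  | zero => simp [R.pairs_zero]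
  | succ t ih =>
    intro l hl
    have h1 := (Reconnect.region (R.pairs_succ t ht) (c := fun x => C (t, x))
      (R.region_before_reconnect hC ht (ih (Nat.le_of_succ_le ht)))).1 l hl
    rw [← R.region_wait hC ht hl (x := l.src) (by simp [Link.ends]),
      ← R.region_wait hC ht hl (x := l.tgt) (by simp [Link.ends])]
    exact h1

open Classical in
-- Budget of one period: the moves are paid from the chain length, the hypothesis adds to it, and
-- reconnection adds nothing.
theorem regionLen_pairs_succ {t : ℕ} (ht : t < R.horizon) :
    regionLen (fun x => C (t + 1, x)) (R.pairs (t + 1)) +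
        ((R.motions t).map fun n => if C (t, n.before.src) then n.moves.card else 0).sum ≤
      regionLen (fun x => C (t, x)) (R.pairs t) + regionLen (fun x => C (t, x)) (R.hyp t) := by
  have hp := R.region_pairs hC ht.le
  have h1 : regionLen (fun x => C (t + 1, x)) (R.pairs (t + 1)) =
      regionLen (fun x => C (t, x)) (R.pairs (t + 1)) := by
    unfold regionLen
    refine congrArg _ (Multiset.map_congr rfl fun l hl => ?_)
    simp only [R.region_wait hC ht hl (x := l.src) (by simp [Link.ends])]
  have h2 := (Reconnect.region (R.pairs_succ t ht) (c := fun x => C (t, x))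
      (R.region_before_reconnect hC ht hp)).2
  rw [regionLen_add] at h2
  have h3 : regionLen (fun x => C (t, x)) ((R.motions t).map Motion.after) +
      ((R.motions t).map fun n => if C (t, n.before.src) then n.moves.card else 0).sum =
      regionLen (fun x => C (t, x)) (R.pairs t) := by
    rw [← R.motions_before t ht]
    unfold regionLen
    rw [Multiset.map_map, Multiset.map_map, ← Multiset.sum_map_add]
    refine congrArg _ (Multiset.map_congr rfl fun n hn => ?_)
    simp only [Function.comp, (R.region_after hC ht hp hn).1]
    split_ifs
    · exact n.valid.len_add_card
    · rfl
  omega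

open Classical in
-- Telescoping of the budget, which is empty in the initial vacuum.
theorem sum_moves_le_sum_hyp :
    ∑ t ∈ Finset.range R.horizon,
        ((R.motions t).map fun n => if C (t, n.before.src) then n.moves.card else 0).sum ≤
      ∑ t ∈ Finset.range R.horizon, regionLen (fun x => C (t, x)) (R.hyp t) := by
  have key : ∀ H ≤ R.horizon, regionLen (fun x => C (H, x)) (R.pairs H) +
      ∑ t ∈ Finset.range H,
        ((R.motions t).map fun n => if C (t, n.before.src) then n.moves.card else 0).sum ≤
      ∑ t ∈ Finset.range H, regionLen (fun x => C (t, x)) (R.hyp t) := by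
    intro H hH
    induction H with
    | zero => simp [R.pairs_zero, regionLen]
    | succ H ih =>
      have h1 := ih (Nat.le_of_succ_le hH)
      have h2 := R.regionLen_pairs_succ hC hH
      rw [Finset.sum_range_succ, Finset.sum_range_succ]
      omega
  exact le_trans (Nat.le_add_left _ _) (key _ le_rfl)

open Classical in
theorem card_moveEdges_le {t : ℕ} (ht : t < R.horizon) :
    ((R.moveEdges t).filter fun e => C e.1).card ≤
      ((R.motions t).map fun n => if C (t, n.before.src) then n.moves.card else 0).sum := by
  refine card_unionOf_filter_le _ _ _ (fun n : Motion L => C (t, n.before.src)) _ ?_ fun n _ => ?_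
  · intro n hn e he hCe
    rw [Multiset.mem_toFinset] at he
    obtain ⟨m, hm, rfl⟩ := Multiset.mem_map.1 he
    have h1 := (R.region_move hC ht hn hm).1.1 hCe
    have hb : n.before ∈ R.pairs t := by
      rw [← R.motions_before t ht]
      exact Multiset.mem_map_of_mem _ hn
    have h2 := R.region_pairs hC ht.le _ hb
    have h3 := n.valid.mem_moves hm
    rcases h3 with h3 | h3 <;> rw [h3] at h1
    · exact h1
    · exact h2.2 h1
  · exact (Multiset.toFinset_card_le _).trans (by simp)

open Classical in
theorem card_waitEdges_le {t : ℕ} (ht : t < R.horizon) :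
    ((R.waitEdges t).filter fun e => C e.1).card ≤
      ((R.pairs (t + 1)).map fun l => if C (t + 1, l.src) then 2 else 0).sum := by
  refine card_unionOf_filter_le _ _ _ (fun l : Link L => C (t + 1, l.src)) (fun _ => 2) ?_
    fun l _ => Finset.card_le_two
  intro l hl e he hCe
  simp only [Finset.mem_insert, Finset.mem_singleton] at he
  have h2 := R.region_pairs hC ht l hl
  rcases he with rfl | rfl
  · exact (R.region_wait hC ht hl (by simp [Link.ends])).1 hCe
  · exact h2.2 ((R.region_wait hC ht hl (by simp [Link.ends])).1 hCe)

open Classical in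
theorem card_hypEdges_le {t : ℕ} (ht : t < R.horizon) :
    ((R.hypEdges t).filter fun e => C e.1).card ≤ regionLen (fun x => C (t, x)) (R.hyp t) := by
  refine card_unionOf_filter_le _ _ _ (fun l : Link L => C (t, l.src)) _ ?_ fun l _ => ?_
  · intro l hl e he hCe
    have h1 := ((joined_of_mem_pathEdges he).mono (R.pathEdges_subset_hyp ht hl)).invariant hC
    simp only [proj, toCell_liftCell] at h1
    exact h1.mpr hCe
  · refine (card_pathEdges_le _ _).trans ?_
    simp [Link.len, Nat.dist_self]

open Classical in
theorem card_fermiEdges_le :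
    (R.fermiEdges.filter fun e => C e.1).card ≤
      (R.fermi.map fun l => if C l.src then l.len else 0).sum := by
  refine card_unionOf_filter_le _ _ _ (fun l : STLink L => C l.src) _ ?_ fun l _ => ?_
  · intro l hl e he hCe
    have h1 := ((joined_of_mem_pathEdges he).mono (R.pathEdges_subset_fermi hl)).invariant hC
    simp only [proj, toCell_liftCell] at h1
    exact h1.mpr hCe
  · refine (card_pathEdges_le _ _).trans ?_
    simp [STLink.len]

omit hC [NeZero L] in
open Classical in
-- Every pair present in state `t` causes two detections there and at least one move in period `t`.
-- The index shift costs nothing, because there are no pairs in state `0` and at the horizon.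
theorem sum_waits_le_sum_moves :
    ∑ t ∈ Finset.range R.horizon,
        ((R.pairs (t + 1)).map fun l => if C (t + 1, l.src) then 2 else 0).sum ≤
      2 * ∑ t ∈ Finset.range R.horizon,
        ((R.motions t).map fun n => if C (t, n.before.src) then n.moves.card else 0).sum := by
  set f : ℕ → ℕ := fun t => ((R.pairs t).map fun l => if C (t, l.src) then 2 else 0).sum with hf
  have h1 : ∑ t ∈ Finset.range R.horizon, f (t + 1) = ∑ t ∈ Finset.range R.horizon, f t := by
    have h2 := Finset.sum_range_succ f R.horizon
    have h3 := Finset.sum_range_succ' f R.horizon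
    have h4 : f R.horizon = 0 := by simp [hf, R.pairs_horizon]
    have h5 : f 0 = 0 := by simp [hf, R.pairs_zero]
    omega
  change ∑ t ∈ Finset.range R.horizon, f (t + 1) ≤ _
  rw [h1, Finset.mul_sum]
  refine Finset.sum_le_sum fun t ht => ?_
  simp only [hf]
  rw [← R.motions_before t (Finset.mem_range.1 ht), Multiset.map_map, ← Multiset.sum_map_mul_left]
  refine Multiset.sum_map_le_sum_map _ _ fun n _ => ?_
  have := n.valid.card_pos
  simp only [Function.comp]
  split_ifs <;> omega

end Region

end Run

/-! ### Fermionic flow -/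

/-- The boundary of the part of a chain that lies in a region which its edges do not leave. -/
theorem sum_region {β V : Type} [DecidableEq V] (A : Finset β) (g : β → ZMod 2) (s t : β → V)
    (C : V → Prop) [DecidablePred C] (h : ∀ b ∈ A, g b ≠ 0 → (C (s b) ↔ C (t b))) (v : V) :
    ∑ b ∈ A.filter fun b => g b ≠ 0 ∧ C (s b),
        ((if s b = v then 1 else 0) + (if t b = v then 1 else 0) : ZMod 2) =
      if C v then ∑ b ∈ A, g b * ((if s b = v then 1 else 0) + (if t b = v then 1 else 0))
      else 0 := by
  have h01 : ∀ a : ZMod 2, a ≠ 0 → a = 1 := by decide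
  rw [Finset.sum_filter]
  by_cases hv : C v
  · rw [if_pos hv]
    refine Finset.sum_congr rfl fun b hb => ?_
    by_cases hg : g b = 0
    · simp [hg]
    · rw [h01 _ hg, one_mul]
      by_cases hs : C (s b)
      · simp [hs]
      · have ht : ¬ C (t b) := fun ht => hs ((h b hb hg).2 ht)
        have h1 : s b ≠ v := fun h1 => hs (h1 ▸ hv)
        have h2 : t b ≠ v := fun h2 => ht (h2 ▸ hv)
        simp [hs, h1, h2]
  · rw [if_neg hv]
    refine Finset.sum_eq_zero fun b hb => ?_
    by_cases hg : g b ≠ 0 ∧ C (s b)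
    · have h1 : s b ≠ v := fun h1 => hv (h1 ▸ hg.2)
      have h2 : t b ≠ v := fun h2 => hv (h2 ▸ (h b hb hg.1).1 hg.2)
      rw [if_pos hg, if_neg h1, if_neg h2, add_zero]
    · rw [if_neg hg]

section Flow

variable {L : ℕ} [NeZero L]

theorem sum_ite_src (H : ℕ) (F : STEdge L → ZMod 2) (v : STVertex L) :
    ∑ e ∈ allEdges L H, F e * (if e.1 = v then 1 else 0) =
      if v.1 < H then ∑ o, F (v, o) else 0 := by
  rw [allEdges, Finset.sum_product]
  simp only [mul_ite, mul_one, mul_zero]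
  rw [Finset.sum_comm]
  simp

omit [NeZero L] in
theorem stTgt_stBack_some (v : STVertex L) (d : Fin 2) : stTgt (stBack v (some d), some d) = v := by
  simp [stTgt, stBack]

theorem sum_ite_tgt_aux (H : ℕ) (F : STEdge L → ZMod 2) (v : STVertex L) (o : Option (Fin 2)) :
    ∑ u ∈ Finset.range H ×ˢ (Finset.univ : Finset (Cell L)),
        F (u, o) * (if stTgt (u, o) = v then 1 else 0) =
      if stTgt (stBack v o, o) = v ∧ (stBack v o).1 < H then F (stBack v o, o) else 0 := by
  have hb : ∀ u, stTgt (u, o) = v → u = stBack v o := fun u h => by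
    have := stBack_stTgt (u, o)
    rw [h] at this
    exact this.symm
  split_ifs with h
  · rw [Finset.sum_eq_single_of_mem (stBack v o) (by simpa using h.2), if_pos h.1, mul_one]
    intro u _ hu
    rw [if_neg fun h' => hu (hb u h'), mul_zero]
  · refine Finset.sum_eq_zero fun u hu => ?_
    rw [if_neg fun h' => h ?_, mul_zero]
    rw [← hb u h']
    exact ⟨h', by simpa using hu⟩

/-- Spatial edges end in the period in which they start, whereas the time edges of periods below `H`
end in periods `1` to `H`. -/
theorem sum_ite_tgt (H : ℕ) (F : STEdge L → ZMod 2) (v : STVertex L) :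
    ∑ e ∈ allEdges L H, F e * (if stTgt e = v then 1 else 0) =
      (if v.1 < H then ∑ d, F (stBack v (some d), some d) else 0) +
        if 1 ≤ v.1 ∧ v.1 ≤ H then F (stBack v none, none) else 0 := by
  rw [allEdges, Finset.sum_product, Finset.sum_comm, Fintype.sum_option, add_comm]
  simp only [sum_ite_tgt_aux, stTgt_stBack_some, true_and]
  congr 1
  · split_ifs with h
    · exact Finset.sum_congr rfl fun d _ => if_pos h
    · exact Finset.sum_eq_zero fun d _ => if_neg h
  · refine if_congr ?_ rfl rfl
    simp only [stBack, stTgt, Prod.ext_iff, and_true]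
    omega

open Classical in
/-- Indicator of the visible fermions. -/
noncomputable def visible (err : ℕ → Edge L → Err) (c : ℕ → Edge L → ZMod 2)
    (pairs : ℕ → Multiset (Link L)) (t : ℕ) (x : Cell L) : ZMod 2 :=
  if PsiVisible err c pairs t x then 1 else 0

omit [NeZero L] in
theorem psiCharge_add_visible {err : ℕ → Edge L → Err} {c : ℕ → Edge L → ZMod 2}
    {pairs : ℕ → Multiset (Link L)} {t : ℕ} {x : Cell L} (h : ∀ l ∈ pairs t, x ∉ l.ends) :
    psiCharge err c t x + visible err c pairs t x = 0 := by
  have h01 : ∀ a : ZMod 2, a ≠ 1 → a = 0 := by decide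
  by_cases hp : psiCharge err c t x = 1
  · have hv : PsiVisible err c pairs t x := ⟨hp, h⟩
    rw [visible, if_pos hv, hp]
    decide
  · have hv : ¬ PsiVisible err c pairs t x := fun hv => hp hv.1
    rw [visible, if_neg hv, h01 _ hp, add_zero]

/-- The flow of fermionic charge that is not visible in the charge measurements: errors, transfers
with anyons, and fermions that have been swallowed by an anyon. -/
noncomputable def flow (err : ℕ → Edge L → Err) (c : ℕ → Edge L → ZMod 2)
    (pairs : ℕ → Multiset (Link L)) : STEdge L → ZMod 2
  | (v, some d) => fermionErr (err v.1) (v.2, d) + c v.1 (v.2, d)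
  -- State `v.1 + 1` is measured at the end of period `v.1`; the sum vanishes unless an anyon hides
  -- the parity of the cell.
  | (v, none) => psiCharge err c (v.1 + 1) v.2 + visible err c pairs (v.1 + 1) v.2

/-- Conservation of fermionic parity: errors and transfers account for the whole change of
`psiCharge`, so mod 2 only the visible charges before and after the period survive. Their sum is `1`
exactly at an unexpected change. -/
theorem flow_boundary {err : ℕ → Edge L → Err} {c : ℕ → Edge L → ZMod 2}
    {pairs : ℕ → Multiset (Link L)} {H : ℕ} (h0 : pairs 0 = 0) (hH : pairs H = 0)
    (v : STVertex L) :
    ∑ e ∈ allEdges L H, flow err c pairs e *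
        ((if e.1 = v then 1 else 0) + (if stTgt e = v then 1 else 0)) = 1 ↔
      v.1 < H ∧
        ¬ (PsiVisible err c pairs v.1 v.2 ↔ PsiVisible err c pairs (v.1 + 1) v.2) := by
  have two : ∀ a : ZMod 2, a + a = 0 := by decide
  have hvoid : ∀ t x, pairs t = 0 → psiCharge err c t x + visible err c pairs t x = 0 := by
    intro t x ht
    exact psiCharge_add_visible (by simp [ht])
  simp only [mul_add, Finset.sum_add_distrib, sum_ite_src, sum_ite_tgt]
  -- The incoming time edge carries the hidden charge of state `v.1`, which vanishes in states `0`
  -- and `H` for lack of anyons; this reconciles the two ranges.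
  have hlast : (if 1 ≤ v.1 ∧ v.1 ≤ H then flow err c pairs (stBack v none, none) else 0) =
      if v.1 < H then psiCharge err c v.1 v.2 + visible err c pairs v.1 v.2 else 0 := by
    rcases Nat.eq_zero_or_pos v.1 with h | h
    · rw [hvoid v.1 v.2 (by rw [h, h0]), if_neg (by omega), ite_self]
    · rcases lt_trichotomy v.1 H with h' | h' | h'
      · rw [if_pos ⟨h, h'.le⟩, if_pos h']
        simp only [flow, stBack, Nat.sub_add_cancel h]
      · rw [if_pos ⟨h, h'.le⟩, if_neg (by omega)]
        simp only [flow, stBack, Nat.sub_add_cancel h]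
        exact hvoid _ _ (by rw [h', hH])
      · rw [if_neg (by omega), if_neg (by omega)]
  rw [hlast]
  by_cases hv : v.1 < H
  · simp only [hv, true_and, if_true]
    have hsum : (∑ o, flow err c pairs (v, o)) + ((∑ d, flow err c pairs (stBack v (some d), some d))
        + (psiCharge err c v.1 v.2 + visible err c pairs v.1 v.2)) =
        visible err c pairs v.1 v.2 + visible err c pairs (v.1 + 1) v.2 := by
      rw [Fintype.sum_option]
      simp only [flow, stBack, psiCharge, Pi.add_apply, boundary, Finset.sum_add_distrib]
      linear_combination two (psiCharge err c v.1 v.2) +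
        two (∑ d, fermionErr (err v.1) (v.2, d)) + two (∑ d, c v.1 (v.2, d)) +
        two (∑ d, fermionErr (err v.1) (v.2 - Pi.single d 1, d)) +
        two (∑ d, c v.1 (v.2 - Pi.single d 1, d))
    rw [hsum]
    simp only [visible]
    by_cases h1 : PsiVisible err c pairs v.1 v.2 <;>
      by_cases h2 : PsiVisible err c pairs (v.1 + 1) v.2 <;> simp [h1, h2, two]
  · simp [hv]

/-- A space-time edge as a string. -/
def edgeLink : STEdge L → STLink L
  | (v, none) => ⟨v, v.1 + 1, 0⟩
  | (v, some d) => ⟨v, v.1, Pi.single d 1⟩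

omit [NeZero L] in
theorem edgeLink_ends (e : STEdge L) : (edgeLink e).ends = {e.1, stTgt e} := by
  obtain ⟨v, _ | d⟩ := e <;> simp [edgeLink, STLink.ends, stTgt, toCell_zero, toCell_single]

omit [NeZero L] in
theorem edgeLink_len (e : STEdge L) : (edgeLink e).len ≤ 1 := by
  obtain ⟨v, _ | d⟩ := e
  · simp [edgeLink, STLink.len, l1, Nat.dist]
  · simp [edgeLink, STLink.len, l1_single, Nat.dist]

open Classical in
-- The part of the hidden flow in `C` has the defects in `C` as its boundary, and decomposing it
-- into strings gives a competitor for the minimal matching.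
theorem exists_fermi_matching {err : ℕ → Edge L → Err} {c : ℕ → Edge L → ZMod 2}
    {pairs : ℕ → Multiset (Link L)} {H : ℕ} (h0 : pairs 0 = 0) (hH : pairs H = 0)
    {C : STVertex L → Prop}
    (hC : ∀ e ∈ allEdges L H, flow err c pairs e ≠ 0 → (C e.1 ↔ C (stTgt e))) :
    ∃ M, IsMatching STLink.ends
      {v | v ∈ {v : ℕ × Cell L | v.1 < H ∧
        ¬ (PsiVisible err c pairs v.1 v.2 ↔ PsiVisible err c pairs (v.1 + 1) v.2)} ∧ C v} M ∧
      (M.map STLink.len).sum ≤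
        ((allEdges L H).filter fun e => flow err c pairs e ≠ 0 ∧ C e.1).card := by
  obtain ⟨M, hM, hM'⟩ := exists_isMatching_boundary STLink.ends STLink.len
    (fun l => ⟨l.src, l.tgt, rfl⟩) (fun l l' u v x h h' => STLink.exists_join h h')
    ((allEdges L H).filter fun e => flow err c pairs e ≠ 0 ∧ C e.1) edgeLink (fun e => e.1) stTgt
    edgeLink_ends edgeLink_len
  refine ⟨M, ?_, hM'⟩
  convert hM using 1
  ext v
  simp only [Set.mem_ofPred_eq]
  rw [sum_region _ _ _ _ _ hC, ← flow_boundary h0 hH]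
  by_cases hv : C v <;> simp [hv]

/-- The boundary of a chain as a sum over its edges. -/
theorem boundary_eq_sum (A : Edge L → ZMod 2) (x : Cell L) :
    boundary A x = ∑ b : Edge L, A b *
      ((if b.1 = x then 1 else 0) + (if b.1 + Pi.single b.2 1 = x then 1 else 0)) := by
  rw [Fintype.sum_prod_type_right, boundary]
  refine Finset.sum_congr rfl fun d _ => ?_
  simp only [mul_add, Finset.sum_add_distrib, ← eq_sub_iff_add_eq]
  simp

open Classical in
-- The actual `σ` errors in the region, joined into strings, are the competitor for the hypothesis.
theorem exists_anyon_matching (e : Edge L → Err) {c : Cell L → Prop}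
    (hc : ∀ b : Edge L, e b = Err.sigma → (c b.1 ↔ c (b.1 + Pi.single b.2 1))) :
    ∃ M, IsMatching Link.ends {x | x ∈ {x | boundary (anyonErr e) x = 1} ∧ c x} M ∧
      (M.map Link.len).sum ≤ (Finset.univ.filter fun b : Edge L => e b = Err.sigma ∧ c b.1).card := by
  have hne : ∀ b, anyonErr e b ≠ 0 ↔ e b = Err.sigma := fun b => by simp [anyonErr]
  obtain ⟨M, hM, hM'⟩ := exists_isMatching_boundary Link.ends Link.len
    (fun l => ⟨l.src, l.tgt, rfl⟩)
    (fun l l' u v x h h' => (Link.exists_join h h').imp fun _ h => ⟨h.1, h.2.1⟩)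
    (Finset.univ.filter fun b : Edge L => anyonErr e b ≠ 0 ∧ c b.1)
    (fun b => ⟨b.1, Pi.single b.2 1⟩) (fun b => b.1) (fun b => b.1 + Pi.single b.2 1)
    (fun b => by simp only [Link.ends, Link.tgt, toCell_single]) (fun b => (l1_single b.2).le)
  refine ⟨M, ?_, by simpa only [hne] using hM'⟩
  convert hM using 1
  ext x
  simp only [Set.mem_ofPred_eq]
  rw [sum_region _ _ _ _ _ (fun b _ hb => hc b ((hne b).1 hb)), ← boundary_eq_sum]
  by_cases hx : c x <;> simp [hx]

end Flow

/-! ### Density of errors in a component -/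

namespace Run

variable {L : ℕ} [NeZero L] {err : ℕ → Edge L → Err} (R : Run err)

theorem mem_errorEdges {t : ℕ} {b : Edge L} (h : err t b ≠ Err.none) :
    (((t, b.1), some b.2) : STEdge L) ∈ R.errorEdges := by
  refine Finset.mem_filter.2 ⟨mem_allEdges.2 ?_, b.2, rfl, h⟩
  by_contra hcon
  exact h (R.quiet t (not_lt.1 hcon) b)

/-- Unobserved fermionic flow occurs on edges with errors or anyons only. -/
theorem mem_of_flow_ne_zero {e : STEdge L} (he : e ∈ allEdges L R.horizon)
    (h : flow err R.transfer R.pairs e ≠ 0) :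
    e ∈ R.errorEdges ∪ (Finset.range R.horizon).biUnion R.moveEdges ∪
      (Finset.range R.horizon).biUnion R.waitEdges := by
  obtain ⟨⟨t, x⟩, _ | d⟩ := e
  · have ht : t < R.horizon := mem_allEdges.1 he
    refine Finset.mem_union_right _ (Finset.mem_biUnion.2 ⟨t, Finset.mem_range.2 ht, ?_⟩)
    by_contra hcon
    exact h (psiCharge_add_visible fun l hl hx => hcon (R.mem_waitEdges hl hx))
  · have ht : t < R.horizon := mem_allEdges.1 he
    refine Finset.mem_union_left _ ?_
    by_cases hf : err t (x, d) = Err.none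
    · have hc : R.transfer t (x, d) ≠ 0 := by
        intro hc
        exact h (by simp [flow, fermionErr, hf, hc])
      rcases R.transfer_spec t ht _ hc with hs | ⟨n, hn, m, hm, hmb⟩
      · rw [hf] at hs; exact absurd hs (by decide)
      · refine Finset.mem_union_right _ (Finset.mem_biUnion.2 ⟨t, Finset.mem_range.2 ht, ?_⟩)
        have := R.mem_moveEdges hn hm
        rwa [moveEdge, hmb] at this
    · exact Finset.mem_union_left _ (R.mem_errorEdges hf)

theorem mem_edges_of_flow_ne_zero {e : STEdge L} (he : e ∈ allEdges L R.horizon)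
    (h : flow err R.transfer R.pairs e ≠ 0) : e ∈ R.edges :=
  Finset.mem_union_left _ (Finset.mem_union_left _ (R.mem_of_flow_ne_zero he h))

section Region

variable {C : STVertex L → Prop} (hC : ∀ e ∈ R.edges, C e.1 = C (stTgt e))

include hC

open Classical in
theorem regionLen_hyp_le {t : ℕ} (ht : t < R.horizon) :
    regionLen (fun x => C (t, x)) (R.hyp t) ≤
      (Finset.univ.filter fun b : Edge L => err t b = Err.sigma ∧ C (t, b.1)).card := by
  obtain ⟨N, hN, hN'⟩ := exists_anyon_matching (err t) (c := fun x => C (t, x)) (fun b hb => by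
    have := hC _ (R.errorEdges_subset (R.mem_errorEdges (b := b) (t := t) (by rw [hb]; decide)))
    exact iff_of_eq this)
  have h1 := (R.hyp_spec t ht).sum_le_of_region (fun l => C (t, l.src)) (fun x => C (t, x))
    (fun l hl v hv => by
      simp only [Link.ends, Multiset.insert_eq_cons, Multiset.mem_cons,
        Multiset.mem_singleton] at hv
      rcases hv with rfl | rfl
      · exact Iff.rfl
      · exact (R.region_hyp hC ht hl).symm) hN
  exact h1.trans hN'

open Classical in
-- Local minimality of the fermionic matching against the hidden flow, which lives on errors, moves
-- and detections.
theorem sum_fermi_le :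
    (R.fermi.map fun l => if C l.src then l.len else 0).sum ≤
      ((R.errorEdges ∪ (Finset.range R.horizon).biUnion R.moveEdges ∪
      (Finset.range R.horizon).biUnion R.waitEdges).filter fun e => C e.1).card := by
  obtain ⟨N, hN, hN'⟩ := exists_fermi_matching (err := err) (c := R.transfer) R.pairs_zero
    R.pairs_horizon (C := C) (fun e he h => iff_of_eq (hC e (R.mem_edges_of_flow_ne_zero he h)))
  have h1 := R.fermi_spec.sum_le_of_region (fun l => C l.src) C (fun l hl v hv => by
      have h2 : v = l.src ∨ v = l.tgt := by
        simpa only [STLink.ends, STLink.tgt, Multiset.insert_eq_cons, Multiset.mem_cons,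
          Multiset.mem_singleton] using hv
      rcases h2 with rfl | rfl
      · exact Iff.rfl
      · exact (R.region_fermi hC hl).symm) hN
  refine h1.trans (hN'.trans (Finset.card_le_card fun e he => ?_))
  rw [Finset.mem_filter] at he ⊢
  exact ⟨R.mem_of_flow_ne_zero he.1 he.2.1, he.2.2⟩

open Classical in
/-- In every connected component, at least one edge in nine carries an error. -/
theorem card_edges_le :
    (R.edges.filter fun e => C e.1).card ≤ 9 * (R.errorEdges.filter fun e => C e.1).card := by
  set H := Finset.range R.horizon with hH
  have hmov : ((H.biUnion R.moveEdges).filter fun e => C e.1).card ≤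
      ∑ t ∈ H, ((R.motions t).map fun n => if C (t, n.before.src) then n.moves.card else 0).sum :=
    (card_biUnion_filter_le _ _ _).trans
      (Finset.sum_le_sum fun t ht => R.card_moveEdges_le hC (Finset.mem_range.1 ht))
  have hwait : ((H.biUnion R.waitEdges).filter fun e => C e.1).card ≤
      ∑ t ∈ H, ((R.pairs (t + 1)).map fun l => if C (t + 1, l.src) then 2 else 0).sum :=
    (card_biUnion_filter_le _ _ _).trans
      (Finset.sum_le_sum fun t ht => R.card_waitEdges_le hC (Finset.mem_range.1 ht))
  have hhyp : ((H.biUnion R.hypEdges).filter fun e => C e.1).card ≤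
      ∑ t ∈ H, regionLen (fun x => C (t, x)) (R.hyp t) :=
    (card_biUnion_filter_le _ _ _).trans
      (Finset.sum_le_sum fun t ht => R.card_hypEdges_le hC (Finset.mem_range.1 ht))
  have herr : ∑ t ∈ H, regionLen (fun x => C (t, x)) (R.hyp t) ≤
      (R.errorEdges.filter fun e => C e.1).card := by
    refine (Finset.sum_le_sum fun t ht => R.regionLen_hyp_le hC (Finset.mem_range.1 ht)).trans ?_
    rw [← Finset.card_sigma]
    refine Finset.card_le_card_of_injOn (fun b => ((b.1, b.2.1), some b.2.2)) ?_ ?_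
    · rintro ⟨t, b⟩ hb
      simp only [Finset.coe_sigma, Set.mem_sigma_iff, Finset.mem_coe, Finset.mem_filter] at hb
      exact Finset.mem_coe.2 (Finset.mem_filter.2
        ⟨R.mem_errorEdges (by rw [hb.2.2.1]; decide), hb.2.2.2⟩)
    · rintro ⟨t, x, d⟩ - ⟨t', x', d'⟩ - h
      simp only [Prod.mk.injEq, Option.some.injEq] at h
      obtain ⟨⟨rfl, rfl⟩, rfl⟩ := h
      rfl
  have h1 := R.sum_moves_le_sum_hyp hC
  have h2 := R.sum_waits_le_sum_moves (C := C)
  have h3 := R.card_fermiEdges_le hC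
  have h4 := R.sum_fermi_le hC
  rw [← hH] at h1 h2 h4
  have h5 : ∀ A B : Finset (STEdge L), ((A ∪ B).filter fun e => C e.1).card ≤
      (A.filter fun e => C e.1).card + (B.filter fun e => C e.1).card := fun A B => by
    rw [Finset.filter_union]; exact Finset.card_union_le _ _
  have h6 := h5 R.errorEdges (H.biUnion R.moveEdges)
  have h7 := h5 (R.errorEdges ∪ H.biUnion R.moveEdges) (H.biUnion R.waitEdges)
  have h8 := h5 (R.errorEdges ∪ H.biUnion R.moveEdges ∪ H.biUnion R.waitEdges)
    (H.biUnion R.hypEdges)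
  have h9 := h5 (R.errorEdges ∪ H.biUnion R.moveEdges ∪ H.biUnion R.waitEdges ∪
    H.biUnion R.hypEdges) R.fermiEdges
  rw [edges, ← hH]
  -- With `E` errors in the region: errors `E`, hypothesis `E`, moves `E`, detections `2E`, and
  -- fermionic strings at most `E + E + 2E`.
  omega

end Region

end Run
/-! ### Winding -/

theorem liftCell_nonneg {L : ℕ} (x : Cell L) (d : Fin 2) : 0 ≤ liftCell x d := Int.natCast_nonneg _

theorem liftCell_lt {L : ℕ} [NeZero L] (x : Cell L) (d : Fin 2) : liftCell x d < L :=
  Int.ofNat_lt.2 (ZMod.val_lt (x d))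

namespace Run

variable {L : ℕ} [NeZero L] {err : ℕ → Edge L → Err} (R : Run err)

theorem liftJoined_of_anyonStep {v w : ℕ × Disp} (h : R.AnyonStep v w) :
    LiftJoined R.edges v w := by
  cases h with
  | error t y d ht h =>
    exact .of_mem (v := (t, y)) (o := some d) (R.errorEdges_subset
      (R.mem_errorEdges (b := (toCell L y, d)) (by rw [h]; decide)))
  | move t y d ht h =>
    obtain ⟨n, hn, m, hm, hmb⟩ := h
    refine .of_mem (v := (t, y)) (o := some d) (R.mem_edges_of_move ht ?_)
    have := R.mem_moveEdges hn hm
    rwa [moveEdge, hmb] at this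
  | wait t y ht h =>
    obtain ⟨l, hl, hy⟩ := h
    exact .of_mem (v := (t, y)) (o := none) (R.mem_edges_of_wait ht (R.mem_waitEdges hl hy))

/-- Both end points of a closed path project to the same vertex, so constancy of the corrected sheet
number leaves no room for a nonzero winding. -/
theorem not_anyonFailure [DecidableRel (Joined R.edges)]
    (h : ∀ v, (R.edges.filter fun e => Joined R.edges v e.1).card < L) : ¬ R.AnyonFailure := by
  rintro ⟨t, y, w, hw, hj⟩
  refine hw (funext fun d => ?_)
  obtain ⟨s, hs⟩ := exists_potential R.edges h d
  have hlift : LiftJoined R.edges (t, y) (t, y + fun d => (L : ℤ) * w d) := by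
    generalize (t, y) = a at hj
    generalize (t, y + fun d => (L : ℤ) * w d) = b at hj
    induction hj with
    | rel _ _ h => exact R.liftJoined_of_anyonStep h
    | refl => exact .refl _
    | symm _ _ _ ih => exact .symm _ _ ih
    | trans _ _ _ _ _ ih ih' => exact .trans _ _ _ ih ih'
  have hproj : proj L (t, y + fun d => (L : ℤ) * w d) = proj L (t, y) := by
    simp only [proj, Prod.mk.injEq, true_and]
    funext d
    simp [toCell]
  have h1 := hs _ _ hlift
  have hL : (L : ℤ) ≠ 0 := by exact_mod_cast NeZero.ne L
  rw [hproj] at h1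
  simp only [Pi.add_apply, Int.add_mul_ediv_left _ _ hL] at h1
  simp only [Pi.zero_apply]
  omega

omit [NeZero L] in
theorem sum_map_ends {β : Type} [AddCommMonoid β] (f : ℕ × Cell L → β) (M : Multiset (STLink L)) :
    (M.map fun l => f l.src + f l.tgt).sum = ((M.bind STLink.ends).map f).sum := by
  induction M using Multiset.induction with
  | empty => simp
  | cons l M ih =>
    rw [Multiset.map_cons, Multiset.sum_cons, ih, Multiset.cons_bind, Multiset.map_add,
      Multiset.sum_add]
    simp [STLink.ends, STLink.tgt]

/-- On the edges used, the coboundary of the potential mod 2 is the indicator of the seam. Pairing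
it with the hidden flow counts the seam crossings of errors and transfers; by summation by parts
this equals the sum of the potential over the defects, which is also the number of crossings of the
matching mod 2. The two contributions cancel. -/
theorem fermionWinding_eq_zero [DecidableRel (Joined R.edges)]
    (h : ∀ v, (R.edges.filter fun e => Joined R.edges v e.1).card < L) (d : Fin 2) :
    R.fermionWinding d = 0 := by
  classical
  obtain ⟨s, hs⟩ := exists_potential R.edges h d
  have hL : (0 : ℤ) < L := by exact_mod_cast NeZero.pos L
  have two : ∀ a : ZMod 2, a + a = 0 := by decide
  have hsub : ∀ a b : ZMod 2, a - b = b + a := by decide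
  set σ : STVertex L → ZMod 2 := fun v => (s v : ZMod 2) with hσ
  have hval : ∀ x : Cell L, liftCell x d / (L : ℤ) = 0 := fun x =>
    Int.ediv_eq_zero_of_lt (liftCell_nonneg x d) (liftCell_lt x d)
  -- Lifted from the fundamental domain, an edge changes the sheet exactly if it has direction `d`
  -- and starts at coordinate `L - 1`.
  have hcross : ∀ e ∈ R.edges, σ e.1 + σ (stTgt e) =
      if e.2 = some d ∧ e.1.2 d + 1 = 0 then 1 else 0 := by
    rintro ⟨⟨t, x⟩, o⟩ he
    have hp : proj L (t, liftCell x) = (t, x) := by simp [proj, toCell_liftCell]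
    have h1 := hs _ _ (LiftJoined.of_mem (v := (t, liftCell x)) (o := o) (by rwa [hp]))
    rw [← stTgt_proj, hp, hval x] at h1
    have h2 : s (stTgt ((t, x), o)) - s (t, x) =
        (liftStep (t, liftCell x) o).2 d / (L : ℤ) := by linarith
    have h3 : σ (t, x) + σ (stTgt ((t, x), o)) =
        (((liftStep (t, liftCell x) o).2 d / (L : ℤ) : ℤ) : ZMod 2) := by
      rw [← h2, ← hsub]; push_cast; rfl
    rw [h3]
    match o with
    | none => simp [liftStep, hval]
    | some d' =>
      by_cases hd : d' = d
      · subst hd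
        simp only [liftStep, Pi.add_apply, Pi.single_eq_same, true_and]
        have hz : x d' + 1 = 0 ↔ liftCell x d' + 1 = L := by
          have h5 : x d' + 1 = ((liftCell x d' + 1 : ℤ) : ZMod L) := by simp [liftCell]
          have h6 := liftCell_nonneg x d'
          have h7 := liftCell_lt x d'
          rw [h5, ZMod.intCast_zmod_eq_zero_iff_dvd]
          constructor
          · intro h8
            have := Int.le_of_dvd (by omega) h8
            omega
          · intro h8; rw [h8]
        by_cases hx : x d' + 1 = 0
        · rw [if_pos hx, hz.1 hx, Int.ediv_self hL.ne']; rfl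
        · rw [if_neg hx, int_succ_ediv hL, hval]
          · rfl
          · intro h8
            refine hx ?_
            have h5 : x d' + 1 = ((liftCell x d' + 1 : ℤ) : ZMod L) := by simp [liftCell]
            rw [h5, ZMod.intCast_zmod_eq_zero_iff_dvd]
            exact h8
      · have : (liftStep (t, liftCell x) (some d')).2 d = liftCell x d := by
          simp [liftStep, Ne.symm hd]
        rw [this, hval, if_neg]
        · rfl
        · rintro ⟨h9, -⟩; exact hd (Option.some.inj h9)
  have hcrossings : ∀ l ∈ R.fermi, ((l.crossings d : ℤ) : ZMod 2) = σ l.src + σ l.tgt := by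
    intro l hl
    have h1 := hs _ _ (R.liftJoined_fermi hl)
    have hp : proj L (l.src.1, liftCell l.src.2) = l.src := by simp [proj, toCell_liftCell]
    have hp' : proj L (l.time, liftCell l.src.2 + l.disp) = l.tgt := by
      simp [proj, STLink.tgt, toCell_add, toCell_liftCell]
    rw [hp, hp'] at h1
    simp only [hval] at h1
    have h2 : l.crossings d = s l.tgt - s l.src := by
      have : l.crossings d = (liftCell l.src.2 + l.disp) d / (L : ℤ) := rfl
      rw [this]; linarith
    rw [h2, ← hsub]; push_cast; rfl
  set F := flow err R.transfer R.pairs with hF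
  -- One layer more than there are periods, for the final vertices of the last time edges.
  set V : Finset (STVertex L) := Finset.range (R.horizon + 1) ×ˢ Finset.univ with hV
  set D : STVertex L → Prop := fun v => v.1 < R.horizon ∧
    ¬ (PsiVisible err R.transfer R.pairs v.1 v.2 ↔ PsiVisible err R.transfer R.pairs (v.1 + 1) v.2)
    with hD
  have hbind : R.fermi.bind STLink.ends = (V.filter D).val := by
    refine (Multiset.Nodup.ext R.fermi_spec.1.1 (Finset.nodup _)).2 fun v => ?_
    rw [R.fermi_spec.1.2 v, Finset.mem_val, Finset.mem_filter]
    refine ⟨fun hv => ⟨?_, hv⟩, fun hv => hv.2⟩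
    have : v.1 < R.horizon := hv.1
    simp only [hV, Finset.mem_product, Finset.mem_range, Finset.mem_univ, and_true]
    omega
  have hsum1 : (R.fermi.map fun l => ((l.crossings d : ℤ) : ZMod 2)).sum =
      ∑ v ∈ V.filter D, σ v := by
    rw [Multiset.map_congr rfl hcrossings, sum_map_ends, hbind]
    rfl
  have hbd : ∀ v, (if D v then σ v else 0) = σ v * ∑ e ∈ allEdges L R.horizon, F e *
        ((if e.1 = v then 1 else 0) + (if stTgt e = v then 1 else 0)) := by
    intro v
    have h01 : ∀ a : ZMod 2, a ≠ 1 → a = 0 := by decide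
    have h1 := flow_boundary (err := err) (c := R.transfer) R.pairs_zero R.pairs_horizon v
    by_cases hv : D v
    · rw [if_pos hv, h1.2 hv, mul_one]
    · rw [if_neg hv, h01 _ fun hh => hv (h1.1 hh), mul_zero]
  have hsum2 : ∑ v ∈ V.filter D, σ v =
      ∑ e ∈ allEdges L R.horizon, F e * (σ e.1 + σ (stTgt e)) := by
    rw [Finset.sum_filter, Finset.sum_congr rfl fun v _ => hbd v]
    simp only [Finset.mul_sum]
    rw [Finset.sum_comm]
    refine Finset.sum_congr rfl fun e he => ?_
    have hlt : e.1.1 < R.horizon := mem_allEdges.1 he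
    have hmV : ∀ v : STVertex L, v.1 ≤ R.horizon → v ∈ V := fun v hv =>
      Finset.mem_product.2 ⟨Finset.mem_range.2 (Nat.lt_succ_of_le hv), Finset.mem_univ _⟩
    have h1 : e.1 ∈ V := hmV _ hlt.le
    have h2 : stTgt e ∈ V := by
      obtain ⟨v, _ | d⟩ := e
      · exact hmV _ hlt
      · exact hmV _ hlt.le
    calc ∑ v ∈ V, σ v * (F e * ((if e.1 = v then 1 else 0) + (if stTgt e = v then 1 else 0)))
        = ∑ v ∈ V, (F e * (if e.1 = v then σ v else 0) +
            F e * (if stTgt e = v then σ v else 0)) := by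
          refine Finset.sum_congr rfl fun v _ => ?_
          split_ifs <;> ring
      _ = F e * (σ e.1 + σ (stTgt e)) := by
          rw [Finset.sum_add_distrib, ← Finset.mul_sum, ← Finset.mul_sum, Finset.sum_ite_eq,
            Finset.sum_ite_eq, if_pos h1, if_pos h2, mul_add]
  have hsum3 : ∑ e ∈ allEdges L R.horizon, F e * (σ e.1 + σ (stTgt e)) =
      ∑ t ∈ Finset.range R.horizon, ∑ x : Cell L with x d + 1 = 0,
        (fermionErr (err t) (x, d) + R.transfer t (x, d)) := by
    have h1 : ∀ e ∈ allEdges L R.horizon, F e * (σ e.1 + σ (stTgt e)) =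
        if e.2 = some d ∧ e.1.2 d + 1 = 0 then F e else 0 := by
      intro e he
      by_cases hf : F e = 0
      · simp [hf]
      · rw [hcross e (R.mem_edges_of_flow_ne_zero he hf), mul_ite, mul_one, mul_zero]
    rw [Finset.sum_congr rfl h1, allEdges, Finset.sum_product, Finset.sum_product]
    refine Finset.sum_congr rfl fun t _ => ?_
    rw [Finset.sum_filter]
    refine Finset.sum_congr rfl fun x _ => ?_
    rw [Finset.sum_eq_single_of_mem (some d) (Finset.mem_univ _)]
    · simp [hF, flow]
    · intro o _ ho
      rw [if_neg fun hh => ho hh.1]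
  rw [fermionWinding, hsum1, hsum2, hsum3, two]

open Classical in
/-- A logical error is caused by a large cluster, in which at least one edge in nine carries an
error. -/
theorem exists_cluster_of_failure (h : R.AnyonFailure ∨ R.FermionFailure) :
    ∃ (e : STEdge L) (K : Finset (STEdge L)), e ∈ R.errorEdges ∧ IsCluster e.1 K ∧ L ≤ K.card ∧
      K.card ≤ 9 * (R.errorEdges.filter fun e => e ∈ K).card := by
  have hex : ∃ v, L ≤ (R.edges.filter fun e => Joined R.edges v e.1).card := by
    by_contra hcon
    push Not at hcon
    rcases h with h | ⟨d, h⟩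
    · exact R.not_anyonFailure hcon h
    · exact h (R.fermionWinding_eq_zero hcon d)
  obtain ⟨v, hv⟩ := hex
  have hC : ∀ e ∈ R.edges, Joined R.edges v e.1 = Joined R.edges v (stTgt e) := fun e he =>
    propext ⟨fun h => h.trans _ _ _ (Joined.of_mem he),
      fun h => h.trans _ _ _ ((Joined.of_mem he).symm _ _)⟩
  have hcard := R.card_edges_le hC
  -- The large component contains an error. Starting the cluster there confines its starting vertex
  -- to the periods with errors.
  have hpos : 0 < (R.errorEdges.filter fun e => Joined R.edges v e.1).card := by
    have := NeZero.pos L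
    omega
  obtain ⟨e, he⟩ := Finset.card_pos.1 hpos
  rw [Finset.mem_filter] at he
  refine ⟨e, _, he.1, isCluster_component R.edges (R.errorEdges_subset he.1) he.2, hv,
    hcard.trans (Nat.mul_le_mul_left _ (Finset.card_le_card fun e' he' => ?_))⟩
  rw [Finset.mem_filter] at he' ⊢
  exact ⟨he'.1, Finset.mem_filter.2 ⟨R.errorEdges_subset he'.1, he'.2⟩⟩

end Run

/-- Truncation only removes errors, so the errors of the run are among those that `errorCount ω`
counts. -/
theorem exists_cluster_of_fails {L T : ℕ} [NeZero L] {ω : Fin T → Edge L → Err} (h : Fails ω) :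
    ∃ (k : Fin T) (x : Cell L) (K : Finset (STEdge L)), IsCluster ((k : ℕ), x) K ∧ L ≤ K.card ∧
      K.card ≤ 9 * errorCount ω K := by
  classical
  obtain ⟨t, -, R, hR⟩ := h
  obtain ⟨e, K, he, hK, hL, hcard⟩ := R.exists_cluster_of_failure hR
  have herr : ∀ e ∈ R.errorEdges, ∃ (k : Fin T) (b : Edge L),
      e = (((k : ℕ), b.1), some b.2) ∧ ω k b ≠ Err.none := by
    rintro ⟨⟨s, x⟩, o⟩ he
    obtain ⟨-, d, ho, hd⟩ := Finset.mem_filter.1 he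
    simp only at ho hd
    subst ho
    rw [truncate] at hd
    split_ifs at hd with h1 h2
    · exact ⟨⟨s, h1⟩, (x, d), rfl, hd⟩
    · exact absurd rfl hd
    · exact absurd rfl hd
  obtain ⟨k, b, rfl, -⟩ := herr e he
  refine ⟨k, b.1, K, hK, hL, hcard.trans (Nat.mul_le_mul_left _ ?_)⟩
  have hcount : errorCount ω K = (Finset.univ.filter fun a : Fin T × Edge L =>
      (((a.1 : ℕ), a.2.1), some a.2.2) ∈ K ∧ ω a.1 a.2 ≠ Err.none).card := by
    rw [errorCount, Finset.card_filter, Fintype.sum_prod_type]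
  rw [hcount]
  refine Finset.card_le_card_of_surjOn (fun a => (((a.1 : ℕ), a.2.1), some a.2.2)) ?_
  intro e' he'
  rw [Finset.mem_coe, Finset.mem_filter] at he'
  obtain ⟨k', b', rfl, hne⟩ := herr e' he'.1
  exact ⟨(k', b'), by simpa using ⟨he'.2, hne⟩, rfl⟩

/-! ### Existence of a run -/

section Existence

variable {L : ℕ}

theorem exists_advance {l : Link L} (h : l.disp ≠ 0) : ∃ l' ms, Advance l l' ms := by
  obtain ⟨s, hs⟩ := exists_dir_toward (v := l.disp) fun h0 => h (l1_eq_zero h0)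
  by_cases h0 : l1 (l.disp - s.vec) = 0
  · exact ⟨_, _, .first l s (sub_eq_zero.1 (l1_eq_zero h0))⟩
  · obtain ⟨s', hs'⟩ := exists_dir_toward h0
    exact ⟨_, _, .both l s s' (by omega)⟩

theorem exists_motions (Q : Multiset (Link L)) (h : ∀ l ∈ Q, l.disp ≠ 0) :
    ∃ M : Multiset (Motion L), M.map Motion.before = Q := by
  induction Q using Multiset.induction with
  | empty => exact ⟨0, rfl⟩
  | cons l Q ih =>
    obtain ⟨M, hM⟩ := ih fun l hl => h l (Multiset.mem_cons_of_mem hl)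
    obtain ⟨l', ms, ha⟩ := exists_advance (h l (Multiset.mem_cons_self l Q))
    exact ⟨⟨l, l', ms, ha⟩ ::ₘ M, by rw [Multiset.map_cons, hM]⟩

theorem disp_ne_zero_of_nodup {Q : Multiset (Link L)} (h : (Q.bind Link.ends).Nodup) {l : Link L}
    (hl : l ∈ Q) : l.disp ≠ 0 := by
  intro h0
  have h1 : l.ends.Nodup := Multiset.nodup_of_le (Multiset.le_bind Q hl) h
  simp [Link.ends, Link.tgt, h0, toCell_zero] at h1

/-- This keeps the ends of the chains in step with `sigmaCharge`. -/
theorem Advance.parity {l l' : Link L} {ms : Multiset (Move L)} (h : Advance l l' ms)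
    (x : Cell L) :
    ((l'.ends.count x : ℕ) : ZMod 2) = l.ends.count x + moveBoundary ms x := by
  have two : ∀ a : ZMod 2, a + a = 0 := by decide
  have hcount : ∀ l : Link L, ((l.ends.count x : ℕ) : ZMod 2) =
      (if l.src = x then 1 else 0) + (if l.tgt = x then 1 else 0) := by
    intro l
    simp only [Link.ends, Multiset.insert_eq_cons, Multiset.count_cons, Multiset.count_singleton,
      eq_comm (a := x)]
    push_cast
    ring
  rw [hcount, hcount]
  cases h with
  | first s h =>
    have h1 : Move.dest (l.src, s) = l.tgt := by simp only [Move.dest, Link.tgt, h]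
    have h2 : (⟨l.tgt, 0⟩ : Link L).tgt = l.tgt := by simp [Link.tgt, toCell_zero]
    simp only [moveBoundary, Multiset.map_singleton, Multiset.sum_singleton, h1, h2]
    linear_combination -two (if l.src = x then 1 else 0)
  | second s h =>
    have h1 : Move.dest (l.tgt, s.opp) = l.src := by
      simp only [Move.dest, Link.tgt, h, Dir.vec_opp, toCell_neg]; abel
    have h2 : (⟨l.src, 0⟩ : Link L).tgt = l.src := by simp [Link.tgt, toCell_zero]
    simp only [moveBoundary, Multiset.map_singleton, Multiset.sum_singleton, h1, h2]
    linear_combination -two (if l.tgt = x then 1 else 0)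
  | both s s' h =>
    have h1 : Move.dest (l.src, s) = l.src + toCell L s.vec := rfl
    have h2 : (⟨l.src + toCell L s.vec, l.disp - s.vec - s'.vec⟩ : Link L).tgt =
        Move.dest (l.tgt, s'.opp) := by
      simp only [Link.tgt, Move.dest, Dir.vec_opp, toCell_sub, toCell_neg]
      abel
    simp only [moveBoundary, Multiset.insert_eq_cons, Multiset.map_cons, Multiset.map_singleton,
      Multiset.sum_cons, Multiset.sum_singleton, h1, h2]
    linear_combination -two (if l.src = x then 1 else 0) - two (if l.tgt = x then 1 else 0)

theorem motions_parity (M : Multiset (Motion L)) (x : Cell L) :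
    (((((M.map Motion.after).bind Link.ends).count x : ℕ)) : ZMod 2) =
      (((M.map Motion.before).bind Link.ends).count x : ℕ) +
        moveBoundary (M.map Motion.moves).sum x := by
  induction M using Multiset.induction with
  | empty => simp [moveBoundary]
  | cons n M ih =>
    have h1 : moveBoundary (n.moves + (M.map Motion.moves).sum) x =
        moveBoundary n.moves x + moveBoundary (M.map Motion.moves).sum x := by
      simp only [moveBoundary, Multiset.map_add, Multiset.sum_add]
    simp only [Multiset.map_cons, Multiset.cons_bind, Multiset.count_add, Nat.cast_add, ih,
      n.valid.parity, Multiset.sum_cons, h1]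
    ring

theorem motions_len (M : Multiset (Motion L)) :
    ((M.map Motion.after).map Link.len).sum + M.card ≤
      ((M.map Motion.before).map Link.len).sum := by
  induction M using Multiset.induction with
  | empty => simp
  | cons n M ih =>
    have h1 := n.valid.len_add_card
    have h2 := n.valid.card_pos
    rw [Multiset.map_cons, Multiset.map_cons, Multiset.map_cons, Multiset.map_cons,
      Multiset.sum_cons, Multiset.sum_cons, Multiset.card_cons]
    omega

theorem eq_zero_of_isMatching_empty {M : Multiset (Link L)} {D : Set (Cell L)} (hD : D = ∅)
    (h : IsMatching Link.ends D M) : M = 0 := by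
  refine Multiset.eq_zero_of_forall_notMem fun l hl => ?_
  have := (h.2 l.src).1 (Multiset.mem_bind.2 ⟨l, hl, by simp [Link.ends]⟩)
  rw [hD] at this
  exact this

variable [NeZero L]

/-- Distinct end points force nonzero displacements, so every pair can advance; matching and joining
then restore distinctness. Without errors the hypothesis is empty, and each pair loses at least one
unit of length. -/
theorem exists_period (e : Edge L → Err) (Q : {Q : Multiset (Link L) // (Q.bind Link.ends).Nodup}) :
    ∃ (M : Multiset (Motion L)) (N : Multiset (Link L))
      (Q' : {Q : Multiset (Link L) // (Q.bind Link.ends).Nodup}),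
      M.map Motion.before = Q.1 ∧
      IsMWPM Link.ends Link.len {x | boundary (anyonErr e) x = 1} N ∧
      Relation.ReflTransGen Reconnect (M.map Motion.after + N) Q'.1 ∧
      (∀ x, (((Q'.1.bind Link.ends).count x : ℕ) : ZMod 2) =
        (Q.1.bind Link.ends).count x + boundary (anyonErr e) x +
          moveBoundary (M.map Motion.moves).sum x) ∧
      ((∀ b, e b = Err.none) → (Q'.1.map Link.len).sum + Q.1.card ≤ (Q.1.map Link.len).sum) := by
  classical
  obtain ⟨M, hM⟩ := exists_motions Q.1 fun l hl => disp_ne_zero_of_nodup Q.2 hl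
  obtain ⟨N₀, hN₀, -⟩ := exists_anyon_matching e (c := fun _ => True) (fun _ _ => Iff.rfl)
  simp only [and_true, Set.ofPred_mem_eq] at hN₀
  obtain ⟨N, hN⟩ := exists_isMWPM Link.len hN₀
  obtain ⟨Q', h1, h2, h3, h4⟩ := Reconnect.exists_nodup (M.map Motion.after + N)
  refine ⟨M, N, ⟨Q', h2⟩, hM, hN, h1, fun x => ?_, fun he => ?_⟩
  · have h01 : ∀ a b : ZMod 2, (a = 1 ↔ b = 1) → a = b := by decide
    have h5 : (((N.bind Link.ends).count x : ℕ) : ZMod 2) = boundary (anyonErr e) x :=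
      h01 _ _ (isMatching_parity hN.1 x)
    rw [h3, Multiset.add_bind, Multiset.count_add, Nat.cast_add, motions_parity, hM, h5]
    ring
  · have hD : {x : Cell L | boundary (anyonErr e) x = 1} = ∅ := by
      ext x
      simp [boundary, anyonErr, he]
    have hN0 := eq_zero_of_isMatching_empty hD hN.1
    have h5 := motions_len M
    rw [hN0, add_zero] at h4
    have h6 : M.card = Q.1.card := by rw [← hM, Multiset.card_map]
    rw [hM] at h5
    simp only
    omega

theorem nonempty_run {err : ℕ → Edge L → Err} {T : ℕ} (hT : ∀ t, T ≤ t → ∀ b, err t b = Err.none) :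
    Nonempty (Run err) := by
  classical
  choose mot hyp next h1 h2 h3 h4 h5 using exists_period (L := L)
  let P : ℕ → {Q : Multiset (Link L) // (Q.bind Link.ends).Nodup} := fun t =>
    Nat.rec ⟨0, by simp⟩ (fun t Q => next (err t) Q) t
  have hP : ∀ t, P (t + 1) = next (err t) (P t) := fun t => rfl
  -- Otherwise the total length would decrease by at least one in every period after `T`.
  obtain ⟨H, hH, hPH⟩ : ∃ H, T ≤ H ∧ (P H).1 = 0 := by
    by_contra hcon
    push Not at hcon
    have key : ∀ k, ((P (T + k)).1.map Link.len).sum + k ≤ ((P T).1.map Link.len).sum := by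
      intro k
      induction k with
      | zero => simp
      | succ k ih =>
        have h6 := h5 (err (T + k)) (P (T + k)) (hT _ (Nat.le_add_right _ _))
        have h7 := Multiset.card_pos.2 (hcon (T + k) (Nat.le_add_right _ _))
        have h8 : P (T + (k + 1)) = next (err (T + k)) (P (T + k)) := rfl
        rw [h8]
        omega
    have := key (((P T).1.map Link.len).sum + 1)
    omega
  have hparity : ∀ t x, sigmaCharge err
      (fun k => ((mot (err k) (P k)).map Motion.moves).sum) t x =
      ((((P t).1.bind Link.ends).count x : ℕ) : ZMod 2) := by
    intro t
    induction t with
    | zero => intro x; simp [sigmaCharge, P]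
    | succ t ih =>
      intro x
      rw [hP, h4, sigmaCharge, Pi.add_apply, Pi.add_apply, ih]
  obtain ⟨F₀, hF₀, -⟩ := exists_fermi_matching (err := err) (c := fun _ _ => 0)
    (pairs := fun t => (P t).1) (H := H) rfl hPH (C := fun _ => True) (fun _ _ _ => Iff.rfl)
  simp only [and_true, Set.ofPred_mem_eq] at hF₀
  obtain ⟨F, hF⟩ := exists_isMWPM STLink.len hF₀
  exact ⟨{
    horizon := H
    pairs := fun t => (P t).1
    motions := fun t => mot (err t) (P t)
    hyp := fun t => hyp (err t) (P t)
    transfer := fun _ _ => 0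
    fermi := F
    quiet := fun t ht => hT t (hH.trans ht)
    pairs_zero := rfl
    pairs_horizon := hPH
    motions_before := fun t _ => h1 _ _
    hyp_spec := fun t _ => h2 _ _
    pairs_succ := fun t _ => h3 _ _
    pairs_matching := fun t _ => by
      simp only [hparity]
      exact isMatching_of_nodup (P t).2
    transfer_spec := fun t _ b hb => absurd rfl hb
    fermi_spec := hF }⟩

end Existence

end IsingTorus

/-! ### The threshold -/

/-- Half of the decay rate `1 / 10` absorbs `L ^ 2`: the quadratic term of the exponential series
gives `(L / 20) ^ 2 / 2 ≤ exp (L / 20)`, whence `800`. -/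
theorem sq_mul_pow_le (L : ℕ) :
    (L : ℝ) ^ 2 * (9 / 10) ^ L ≤ 800 * Real.exp (-(1 / 20 * (L : ℝ))) := by
  have h1 : (9 / 10 : ℝ) ≤ Real.exp (-(1 / 10)) := by
    have := Real.add_one_le_exp (-(1 / 10) : ℝ)
    linarith
  have h2 : ((9 / 10 : ℝ)) ^ L ≤ Real.exp (-(1 / 10 * (L : ℝ))) := by
    refine (pow_le_pow_left₀ (by norm_num) h1 L).trans (le_of_eq ?_)
    rw [← Real.exp_nat_mul]
    congr 1
    ring
  have h3 : (L : ℝ) ^ 2 ≤ 800 * Real.exp (1 / 20 * (L : ℝ)) := by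
    have h := Real.pow_div_factorial_le_exp (x := 1 / 20 * (L : ℝ)) (by positivity) 2
    norm_num [Nat.factorial] at h
    nlinarith
  calc (L : ℝ) ^ 2 * (9 / 10) ^ L
      ≤ 800 * Real.exp (1 / 20 * (L : ℝ)) * Real.exp (-(1 / 10 * (L : ℝ))) :=
        mul_le_mul h3 h2 (by positivity) (by positivity)
    _ = 800 * Real.exp (-(1 / 20 * (L : ℝ))) := by
        rw [mul_assoc, ← Real.exp_add]
        congr 2
        ring

theorem theorem1 :
    (∀ (L T : ℕ) [NeZero L] (ω : Fin T → IsingTorus.Edge L → IsingTorus.Err) (t : ℕ),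
      Nonempty (IsingTorus.Run (IsingTorus.truncate ω t))) ∧
    ∃ pc : ℝ, 0 < pc ∧ ((15 : ℝ) ^ 14)⁻¹ ≤ pc ∧
      ∀ p : ℝ, 0 ≤ p → 2 * p < 1 → p < pc →
        ∃ C : ℝ, 0 < C ∧ ∃ c : ℝ, 0 < c ∧ ∀ (L T : ℕ) [NeZero L],
          IsingTorus.failureProb L T p ≤ (T : ℝ) * (C * Real.exp (-(c * (L : ℝ)))) := by
  refine ⟨fun L T _ ω t => IsingTorus.nonempty_run (T := T) fun k hk b => ?_,
    ((15 : ℝ) ^ 14)⁻¹, by positivity, le_rfl, fun p h0 h1 hp => ⟨800, by norm_num, 1 / 20,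
      by norm_num, fun L T _ => ?_⟩⟩
  · rw [IsingTorus.truncate, dif_neg (not_lt.2 hk)]
  -- `q = 1 / 13` maximises `q * (1 - q) ^ 12`, with value about `0.0294`. Then `l = 40` gives `1 /
  -- l = 0.025`, below `9 / 10` of this value, and `p < 15 ^ (-14)` keeps `2 * p * l ^ 9` below
  -- `0.02`, which fits into the gap.
  · refine (IsingTorus.failureProb_le_of_cluster (l := 40) (q := 1 / 13) (ρ := 9 / 10) 9 h0 h1
      (by norm_num) (by norm_num) (by norm_num) (by norm_num) (by norm_num) ?_
      fun ω h => IsingTorus.exists_cluster_of_fails h).trans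
      (mul_le_mul_of_nonneg_left (sq_mul_pow_le L) (Nat.cast_nonneg T))
    have h2 : 2 * p * 40 ^ 9 ≤ 2 * ((15 : ℝ) ^ 14)⁻¹ * 40 ^ 9 := by
      have := hp.le
      gcongr
    refine (div_le_div_of_nonneg_right (add_le_add_right h2 1) (by norm_num)).trans ?_
    norm_num
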